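/- **Setting.** Let $d\ge 1$ and $1\le k_0<k$. For each $n$ let $\{P_\theta=P_{n,\theta}:\theta\in\mathbb R^d\}$ be a (measurable) family of probability distributions on $\mathbb R^n$, let $\eta=\eta_n:\mathbb R^n\to\mathbb R^k$ be measurable summary statistics, and let $\epsilon_n>0$, $\epsilon_n\to0$. Let $\Theta\subset\mathbb R^d$ be the parameter space, $\theta_0\in\Theta$ the true parameter, and $\pi$ a prior probability density vanishing outside $\Theta$, continuous and positive at $\theta_0$. Given data $y$, the ABC posterior density is $$\pi_{\epsilon_n}(\theta\mid\eta(y))=\frac{\pi(\theta)P_\theta(\|\eta(y)-\eta(z)\|\le\epsilon_n)}{\int\pi(\theta')P_{\theta'}(\|\eta(y)-\eta(z)\|\le\epsilon_n)\,d\theta'} ,$$ where $z$ is the random data and $\|\cdot\|$ is Euclidean. Write $g_{(1)}$ for the first $k_0$ (slow) and $g_{(2)}$ for the last $k-k_0$ (fast) components of $g\in\mathbb R^k$. Assume: 1. There are a Lipschitz map $b:\mathbb R^d\to\mathbb R^k$ and rates $0<v_{n1}\le\dots\le v_{nk}$ such that, for all $\theta\in\Theta$ and all $j$, $v_{nj}(b(\theta)_j-\eta(z)_j)=O_P(1)$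 under $z\sim P_\theta$; moreover $v_{nj}\epsilon_n\to0$ for $j\le k_0$ and $v_{nj}\epsilon_n\to\infty$ for $j>k_0$. Put $Z_{n,j}(\theta)=v_{nj}(\eta_j(z)-b_j(\theta))$. 2. $b_{(2)}$ is differentiable at $\theta_0$, its derivative $\nabla b_{(2)}(\theta_0):\mathbb R^d\to\mathbb R^{k-k_0}$ has rank $d$, and $\theta_0$ is identified by $b_{(2)}$: for each $r>0$, $\inf\{\|b_{(2)}(\theta)-b_{(2)}(\theta_0)\|:\theta\in\Theta,\ \|\theta-\theta_0\|\ge r\}>0$. 3. There are $\delta>0$, a strictly positive, bounded, Lipschitz function $\gamma:\mathbb R^{k_0}\to\mathbb R$, a constant $R\ge0$ and a sequence $L_n\to0$ such that, for all compact $K\subset\mathbb R^{k_0}$ and all $0<t\le1$, $$\sup_{\|\theta-\theta_0\|<\delta}\ \sup_{m\in K}\left|\frac{P_\theta\Big(\sum_{j\le k_0}(Z_{n,j}(\theta)-m_j)^2/v_{nj}^2<t^2\epsilon_n^2\Big)}{t^RL_n}-\gamma(m)\right|\to0 .$$ 4. There are $u_0>0$, $\kappa>d$ with $v_{n,k_0+1}^{-\kappa}=o(L_n\epsilon_n^d)$,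 and a function $c$ on $\Theta$, bounded in a neighbourhood of $\theta_0$ and with $\int_\Theta c(\theta)\pi(\theta)\,d\theta<\infty$, such that $P_\theta(|Z_{n,j}(\theta)|>u)\le c(\theta)u^{-\kappa}$ for all $n\ge1$, $u>u_0$, $\theta\in\Theta$ and $j>k_0$. 5. For all $M>0$ there are $M_2>0$, $\kappa>d$ and a non-decreasing sequence $u_n\ge u_0$ with $u_n=o(v_{n,k_0+1}\epsilon_n)$ such that, for all large $n$ and all $u\ge u_n$, $\|\theta-\theta_0\|\le\delta$, $j>k_0$, one has $P_\theta(|Z_{n,j}(\theta)|>u\mid Z_{n,(1)}(\theta)=m)\le M_2u^{-\kappa}$ for almost every $m$ (for the law of $Z_{n,(1)}(\theta)$ under $P_\theta$) with $\|m\|\le M$, and such that $(v_{n,k_0}/v_{n,k_0+1})^{\kappa-d}(\epsilon_nv_{n,k_0+1})^{-d}=o(L_n)$. **Theorem.** Let $$h_n(\theta)=\mathbf 1\{\|\nabla b_{(2)}(\theta_0)(\theta-\theta_0)\|\le\epsilon_n\}\left(1-\frac{\|\nabla b_{(2)}(\theta_0)(\theta-\theta_0)\|^2}{\epsilon_n^2}\right)^{R/2}.$$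 Then $h_n$ is integrable with $\int h_n>0$; with $P_{\theta_0}$-probability tending to $1$ the ABC posterior is well defined (its normalising constant is positive); and its total variation distance to the density proportional to $h_n$ tends to $0$ in $P_{\theta_0}$-probability: $$\frac12\int\left|\pi_{\epsilon_n}(\theta\mid\eta(y))-\frac{h_n(\theta)}{\int h_n}\right|d\theta\ \longrightarrow\ 0\quad\text{in probability, } y\sim P_{\theta_0}.$$ (For $R=0$ the limiting density is that of the uniform distribution on the ellipsoid $\{\|\nabla b_{(2)}(\theta_0)(\theta-\theta_0)\|\le\epsilon_n\}$.) -/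

import Mathlib

open MeasureTheory ProbabilityTheory Filter Topology Asymptotics
open scoped NNReal ENNReal

noncomputable section

namespace ABC

/-- Indices of the slow components (the first `k₀` of the `k` components; indices start at `0`). -/
abbrev SlowIdx (k k₀ : ℕ) : Type := {j : Fin k // (j : ℕ) < k₀}

/-- Indices of the fast components (the last `k - k₀` of the `k` components). -/
abbrev FastIdx (k k₀ : ℕ) : Type := {j : Fin k // k₀ ≤ (j : ℕ)}

/-- The vector `g₍₁₎` of slow components of `g`. -/
def slow {k : ℕ} (k₀ : ℕ) (g : EuclideanSpace ℝ (Fin k)) : EuclideanSpace ℝ (SlowIdx k k₀) :=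
  WithLp.toLp 2 (fun j => g j.1)

/-- The vector `g₍₂₎` of fast components of `g`. -/
def fast {k : ℕ} (k₀ : ℕ) (g : EuclideanSpace ℝ (Fin k)) : EuclideanSpace ℝ (FastIdx k k₀) :=
  WithLp.toLp 2 (fun j => g j.1)

/-- The normalised vector `Z = D (s - b)`, with `D = diag (v j)`: `Z j = v j * (s j - b j)`. -/
def normalised {k : ℕ} (v : Fin k → ℝ) (b s : EuclideanSpace ℝ (Fin k)) :
    EuclideanSpace ℝ (Fin k) :=
  WithLp.toLp 2 (fun j => v j * (s j - b j))

/-- A sequence of real random variables `X n`, each on its own probability space `(Ω n, μ n)`,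
is `O_P(1)`. -/
def BoundedInProbability {Ω : ℕ → Type*} [∀ n, MeasurableSpace (Ω n)]
    (μ : ∀ n, Measure (Ω n)) (X : ∀ n, Ω n → ℝ) : Prop :=
  ∀ e : ℝ, 0 < e → ∃ M : ℝ, ∀ᶠ n in atTop, (μ n).real {z | M < |X n z|} ≤ e

/-- The probability, for data `z` drawn from `μ`, of a summary statistic within `ε` of that of
the observed data `y`: the ABC approximation to the likelihood. -/
def abcLikelihood {Ω : Type*} [MeasurableSpace Ω] {k : ℕ} (μ : Measure Ω)
    (η : Ω → EuclideanSpace ℝ (Fin k)) (ε : ℝ) (y : Ω) : ℝ :=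
  μ.real {z | ‖η y - η z‖ ≤ ε}

/-- The normalising constant `∫ π(θ) P_θ(‖η(y) - η(z)‖ ≤ ε) dθ` of the ABC posterior. -/
def abcEvidence {Ω : Type*} [MeasurableSpace Ω] {d k : ℕ}
    (P : Kernel (EuclideanSpace ℝ (Fin d)) Ω) (η : Ω → EuclideanSpace ℝ (Fin k))
    (π : EuclideanSpace ℝ (Fin d) → ℝ) (ε : ℝ) (y : Ω) : ℝ :=
  ∫ θ, π θ * abcLikelihood (P θ) η ε y

/-- The ABC posterior density given the observed data `y`. -/
def abcPosterior {Ω : Type*} [MeasurableSpace Ω] {d k : ℕ}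
    (P : Kernel (EuclideanSpace ℝ (Fin d)) Ω) (η : Ω → EuclideanSpace ℝ (Fin k))
    (π : EuclideanSpace ℝ (Fin d) → ℝ) (ε : ℝ) (y : Ω) (θ : EuclideanSpace ℝ (Fin d)) : ℝ :=
  π θ * abcLikelihood (P θ) η ε y / abcEvidence P η π ε y

open Classical in
/-- The unnormalised limiting shape
`1{‖B (θ - θ₀)‖ ≤ ε} (1 - ‖B (θ - θ₀)‖² / ε²)^(R/2)`. -/
def limitShape {d : ℕ} {F : Type*} [NormedAddCommGroup F] [NormedSpace ℝ F]
    (B : EuclideanSpace ℝ (Fin d) →L[ℝ] F) (θ₀ : EuclideanSpace ℝ (Fin d)) (R ε : ℝ)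
    (θ : EuclideanSpace ℝ (Fin d)) : ℝ :=
  if ‖B (θ - θ₀)‖ ≤ ε then (1 - ‖B (θ - θ₀)‖ ^ 2 / ε ^ 2) ^ (R / 2) else 0

/-- The probability density proportional to the limiting shape. -/
def limitDensity {d : ℕ} {F : Type*} [NormedAddCommGroup F] [NormedSpace ℝ F]
    (B : EuclideanSpace ℝ (Fin d) →L[ℝ] F) (θ₀ : EuclideanSpace ℝ (Fin d)) (R ε : ℝ)
    (θ : EuclideanSpace ℝ (Fin d)) : ℝ :=
  limitShape B θ₀ R ε θ / ∫ θ', limitShape B θ₀ R ε θ'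

/-- The total variation distance `½ ∫ |f - g|` of two densities with respect to Lebesgue
measure. -/
def tvDist {d : ℕ} (f g : EuclideanSpace ℝ (Fin d) → ℝ) : ℝ≥0∞ :=
  2⁻¹ * ∫⁻ θ, ENNReal.ofReal |f θ - g θ|

end ABC

end

/-! Write θ = θ₀ + ε_n x. The fast statistics concentrate on a scale much smaller than ε_n, so the
fast part of `η y - η z` has norm about `‖b₍₂₎(θ) - b₍₂₎(θ₀)‖`, that is ε_n‖Bx‖. Acceptance then
requires the slow statistics to agree within ε_n(1 - ‖Bx‖²)^(1/2), an event of probability about L_n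
γ(m)(1 - ‖Bx‖²)^(R/2). Here m is the scaled slow part of `η y - b θ₀`; moving θ by O(ε_n) hardly
changes the scaled centre, because v_{nj}ε_n → 0 for slow j. The factors L_n, γ(m) and π(θ₀) cancel
on normalising. It therefore suffices that the unnormalised posterior, divided by these factors, is
within a small multiple of ε_n^d of the shape in L¹, with probability close to 1
(`lintegral_normalize_sub_le`).

The difficulty is that deviations of the fast statistics must be negligible relative to L_n, which
tends to 0. `proxyEvent` separates them: it is the acceptance event as long as no fast component
deviates, and otherwise it uses the deterministic fast distance `‖b₍₂₎(θ) - b₍₂₎(θ₀)‖`. It is thus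
squeezed between events on slow statistics alone, to which the small-ball asymptotics apply with no
conditioning. Dominated convergence gives its L¹ limit (`eventually_lintegral_scaledProxy_sub_le`).

The remaining error is at most the probability of `deviationEvent`. It is averaged over the
observation y as well. By Tonelli one may fix z and let y vary: the slow part of `η y` must fall
within ε_n of that of `η z`, which has probability O(L_n) under θ₀ (for y with bounded scaled slow
part). This supplies the factor L_n, and only the unconditional tail of the fast statistics is left
(`lintegral_deviationMass_le`). With a threshold growing with the distance to θ₀, that tail
integrates to o(ε_n^d) (`exists_lintegral_mul_rpow_le`). Markov's inequality turns the mean over y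
into a bound in probability. -/

noncomputable section

namespace ABC

/-! ### L¹ perturbation of normalised densities -/

/-- Normalising two nonnegative functions at most doubles their relative `L¹` distance. -/
theorem lintegral_normalize_sub_le {α : Type*} [MeasurableSpace α] {μ : Measure α} {f h : α → ℝ}
    (hf : 0 ≤ f) (hfm : AEStronglyMeasurable f μ) (hh : Integrable h μ)
    {D : ℝ} (hD0 : 0 ≤ D) (hD : ∫⁻ x, ENNReal.ofReal |f x - h x| ∂μ ≤ ENNReal.ofReal D)
    (hDI : D < ∫ x, h x ∂μ) :
    0 < ∫ x, f x ∂μ ∧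
      ∫⁻ x, ENNReal.ofReal |f x / (∫ x, f x ∂μ) - h x / (∫ x, h x ∂μ)| ∂μ
        ≤ ENNReal.ofReal (2 * D / ∫ x, h x ∂μ) := by
  have hint : Integrable (fun x => f x - h x) μ := by
    refine ⟨hfm.sub hh.1, ?_⟩
    rw [hasFiniteIntegral_iff_norm]
    exact hD.trans_lt ENNReal.ofReal_lt_top
  have hfi : Integrable f μ := (hint.add hh).congr (ae_of_all _ fun x => by simp)
  have habs : ∫ x, |f x - h x| ∂μ ≤ D := by
    rw [← ofReal_integral_eq_lintegral_ofReal hint.abs (ae_of_all _ fun x => abs_nonneg _)] at hD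
    exact (ENNReal.ofReal_le_ofReal_iff hD0).1 hD
  set F := ∫ x, f x ∂μ with hF
  set I := ∫ x, h x ∂μ with hI
  have hFI : |F - I| ≤ D := by
    rw [hF, hI, ← integral_sub hfi hh]
    exact (abs_integral_le_integral_abs).trans habs
  have hIpos : 0 < I := hD0.trans_lt hDI
  have hFpos : 0 < F := by have := (abs_le.1 hFI).1; linarith
  refine ⟨hFpos, ?_⟩
  -- Compare through `f / I`. Each of the two terms integrates to at most `D / I`, the second
  -- because `f` has integral `F`.
  have hpt : ∀ x, |f x / F - h x / I| ≤ |f x - h x| / I + f x * (D / (F * I)) := by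
    intro x
    have h1 : f x / F - h x / I = (f x - h x) / I + f x * ((I - F) / (F * I)) := by
      field_simp; ring
    rw [h1]
    refine (abs_add_le _ _).trans ?_
    rw [abs_div, abs_of_pos hIpos, abs_mul, abs_of_nonneg (hf x), abs_div,
      abs_of_pos (mul_pos hFpos hIpos)]
    gcongr
    · exact hf x
    · rwa [abs_sub_comm]
  have hint2 : Integrable (fun x => |f x - h x| / I + f x * (D / (F * I))) μ :=
    (hint.abs.div_const _).add (hfi.mul_const _)
  calc ∫⁻ x, ENNReal.ofReal |f x / F - h x / I| ∂μ
      ≤ ∫⁻ x, ENNReal.ofReal (|f x - h x| / I + f x * (D / (F * I))) ∂μ :=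
        lintegral_mono fun x => ENNReal.ofReal_le_ofReal (hpt x)
    _ = ENNReal.ofReal (∫ x, (|f x - h x| / I + f x * (D / (F * I))) ∂μ) := by
        rw [ofReal_integral_eq_lintegral_ofReal hint2]
        exact ae_of_all _ fun x => (abs_nonneg _).trans (hpt x)
    _ ≤ ENNReal.ofReal (2 * D / I) := by
        apply ENNReal.ofReal_le_ofReal
        rw [integral_add (hint.abs.div_const _) (hfi.mul_const _), integral_div,
          integral_mul_const, ← hF]
        have : F * (D / (F * I)) = D / I := by field_simp
        rw [this, two_mul, add_div]
        gcongr

/-! ### Change of variables θ = θ₀ + εx and the limiting shape -/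

section Scaling

variable {d : ℕ}

theorem lintegral_comp_add_smul (g : EuclideanSpace ℝ (Fin d) → ℝ≥0∞)
    (θ₀ : EuclideanSpace ℝ (Fin d)) {ε : ℝ} (hε : 0 < ε) :
    ∫⁻ θ, g θ = ENNReal.ofReal (ε ^ d) * ∫⁻ x, g (θ₀ + ε • x) := by
  have h1 : ∫⁻ x, g (θ₀ + ε • x) = ∫⁻ u, g (θ₀ + u)
      ∂(Measure.map (fun x : EuclideanSpace ℝ (Fin d) => ε • x) volume) := by
    -- A measurable embedding transports the integral of every function, so `g` need not be
    -- measurable.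
    have he : MeasurableEmbedding (fun x : EuclideanSpace ℝ (Fin d) => ε • x) :=
      (Homeomorph.smulOfNeZero ε hε.ne').measurableEmbedding
    exact (he.lintegral_map fun u => g (θ₀ + u)).symm
  rw [h1, Measure.map_addHaar_smul _ hε.ne', lintegral_smul_measure, lintegral_add_left_eq_self g θ₀]
  have : |(ε ^ Module.finrank ℝ (EuclideanSpace ℝ (Fin d)))⁻¹| = (ε ^ d)⁻¹ := by
    rw [finrank_euclideanSpace_fin, abs_of_pos (by positivity)]
  rw [this, smul_eq_mul, ← mul_assoc, ← ENNReal.ofReal_mul (by positivity),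
    mul_inv_cancel₀ (by positivity), ENNReal.ofReal_one, one_mul]

theorem integral_comp_add_smul (g : EuclideanSpace ℝ (Fin d) → ℝ)
    (θ₀ : EuclideanSpace ℝ (Fin d)) {ε : ℝ} (hε : 0 < ε) :
    ∫ θ, g θ = ε ^ d * ∫ x, g (θ₀ + ε • x) := by
  rw [Measure.integral_comp_smul volume (fun u => g (θ₀ + u)) ε, integral_add_left_eq_self g θ₀,
    finrank_euclideanSpace_fin, abs_of_pos (by positivity), smul_eq_mul, ← mul_assoc,
    mul_inv_cancel₀ (by positivity), one_mul]

end Scaling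

section LimitShape

variable {d : ℕ} {F : Type*} [NormedAddCommGroup F] [NormedSpace ℝ F]
  (B : EuclideanSpace ℝ (Fin d) →L[ℝ] F) (θ₀ : EuclideanSpace ℝ (Fin d)) {R ε : ℝ}

theorem sub_sq_div_sq_mem {a ε : ℝ} (ha : 0 ≤ a) (hε : 0 < ε) (h : a ≤ ε) :
    0 ≤ 1 - a ^ 2 / ε ^ 2 ∧ 1 - a ^ 2 / ε ^ 2 ≤ 1 := by
  have h1 : a ^ 2 / ε ^ 2 ≤ 1 := by
    rw [div_le_one (by positivity)]; gcongr
  have h2 : 0 ≤ a ^ 2 / ε ^ 2 := by positivity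
  constructor <;> linarith

theorem limitShape_nonneg (hε : 0 < ε) (θ : EuclideanSpace ℝ (Fin d)) :
    0 ≤ limitShape B θ₀ R ε θ := by
  unfold limitShape
  split_ifs with h
  · exact Real.rpow_nonneg (sub_sq_div_sq_mem (norm_nonneg _) hε h).1 _
  · exact le_rfl

theorem limitShape_le_one (hR : 0 ≤ R) (hε : 0 < ε) (θ : EuclideanSpace ℝ (Fin d)) :
    limitShape B θ₀ R ε θ ≤ 1 := by
  unfold limitShape
  split_ifs with h
  · have := sub_sq_div_sq_mem (norm_nonneg (B (θ - θ₀))) hε h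
    exact Real.rpow_le_one this.1 this.2 (by positivity)
  · exact zero_le_one

theorem measurable_limitShape : Measurable (limitShape B θ₀ R ε) := by
  have hm : Measurable fun θ => ‖B (θ - θ₀)‖ :=
    (by fun_prop : Continuous fun θ => ‖B (θ - θ₀)‖).measurable
  unfold limitShape
  refine Measurable.ite (measurableSet_le hm measurable_const) ?_ measurable_const
  fun_prop

theorem limitShape_add_smul (hε : 0 < ε) (x : EuclideanSpace ℝ (Fin d)) :
    limitShape B θ₀ R ε (θ₀ + ε • x) = limitShape B 0 R 1 x := by
  unfold limitShape
  have h1 : ‖B (θ₀ + ε • x - θ₀)‖ = ε * ‖B x‖ := by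
    rw [add_sub_cancel_left, map_smul, norm_smul, Real.norm_of_nonneg hε.le]
  rw [h1, sub_zero]
  have h2 : ε * ‖B x‖ ≤ ε ↔ ‖B x‖ ≤ 1 := by
    constructor
    · intro h; nlinarith
    · intro h; nlinarith
  have h3 : (ε * ‖B x‖) ^ 2 / ε ^ 2 = ‖B x‖ ^ 2 / 1 ^ 2 := by field_simp
  simp only [h2, h3]

variable {B} in
theorem integrable_limitShape {c : ℝ} (hc : 0 < c) (hB : ∀ x, c * ‖x‖ ≤ ‖B x‖)
    (hR : 0 ≤ R) (hε : 0 < ε) : Integrable (limitShape B θ₀ R ε) := by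
  have h : Integrable ((Metric.closedBall θ₀ (ε / c)).indicator fun _ => (1 : ℝ)) :=
    (integrable_indicator_iff measurableSet_closedBall).2
      (integrableOn_const (isCompact_closedBall _ _).measure_lt_top.ne)
  refine h.mono' (measurable_limitShape B θ₀).aestronglyMeasurable (ae_of_all _ fun θ => ?_)
  rw [Real.norm_of_nonneg (limitShape_nonneg B θ₀ hε θ)]
  by_cases hθ : θ ∈ Metric.closedBall θ₀ (ε / c)
  · rw [Set.indicator_of_mem hθ]
    exact limitShape_le_one B θ₀ hR hε θ
  · rw [Set.indicator_of_notMem hθ]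
    refine le_of_eq (if_neg fun hle => hθ ?_)
    rw [Metric.mem_closedBall, dist_eq_norm, le_div_iff₀ hc, mul_comm]
    exact (hB _).trans hle

variable {B} in
theorem integral_limitShape_pos {c : ℝ} (hc : 0 < c) (hB : ∀ x, c * ‖x‖ ≤ ‖B x‖)
    (hR : 0 ≤ R) (hε : 0 < ε) : 0 < ∫ θ, limitShape B θ₀ R ε θ := by
  rw [integral_pos_iff_support_of_nonneg (fun θ => limitShape_nonneg B θ₀ hε θ)
    (integrable_limitShape θ₀ hc hB hR hε)]
  have hopen : IsOpen {θ : EuclideanSpace ℝ (Fin d) | ‖B (θ - θ₀)‖ < ε} :=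
    isOpen_lt (by fun_prop) continuous_const
  refine (hopen.measure_pos volume ⟨θ₀, by simpa using hε⟩).trans_le (measure_mono ?_)
  intro θ (hθ : ‖B (θ - θ₀)‖ < ε)
  rw [Function.mem_support, limitShape, if_pos hθ.le]
  refine (Real.rpow_pos_of_pos ?_ _).ne'
  rw [sub_pos, div_lt_one (by positivity)]
  gcongr

theorem integral_limitShape_eq (hε : 0 < ε) :
    ∫ θ, limitShape B θ₀ R ε θ = ε ^ d * ∫ x, limitShape B 0 R 1 x := by
  rw [integral_comp_add_smul _ θ₀ hε]
  simp only [limitShape_add_smul B θ₀ hε]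

end LimitShape

/-! ### Injectivity of the derivative, slow and fast components, separation -/

/-- Full column rank leaves no kernel by rank-nullity, and an injective linear map on a
finite-dimensional space is antilipschitz. -/
theorem exists_mul_norm_le_of_finrank_range_eq {d : ℕ} {F : Type*} [NormedAddCommGroup F]
    [NormedSpace ℝ F] (B : EuclideanSpace ℝ (Fin d) →L[ℝ] F)
    (h : Module.finrank ℝ (LinearMap.range B.toLinearMap) = d) :
    ∃ c : ℝ, 0 < c ∧ ∀ x, c * ‖x‖ ≤ ‖B x‖ := by
  have hker : LinearMap.ker B.toLinearMap = ⊥ := by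
    have := LinearMap.finrank_range_add_finrank_ker B.toLinearMap
    rw [h, finrank_euclideanSpace_fin] at this
    exact Submodule.finrank_eq_zero.1 (by omega)
  obtain ⟨K, hK, hA⟩ := B.toLinearMap.exists_antilipschitzWith hker
  refine ⟨(K : ℝ)⁻¹, by positivity, fun x => ?_⟩
  have := hA.le_mul_norm_sub x 0
  rw [inv_mul_le_iff₀ (by positivity)]
  simpa using this

section SlowFast

variable {k : ℕ} (k₀ : ℕ)

theorem slow_sub (g h : EuclideanSpace ℝ (Fin k)) : slow k₀ (g - h) = slow k₀ g - slow k₀ h := rfl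

theorem fast_sub (g h : EuclideanSpace ℝ (Fin k)) : fast k₀ (g - h) = fast k₀ g - fast k₀ h := rfl

theorem norm_sq_eq_slow_add_fast (g : EuclideanSpace ℝ (Fin k)) :
    ‖g‖ ^ 2 = ‖slow k₀ g‖ ^ 2 + ‖fast k₀ g‖ ^ 2 := by
  simp only [EuclideanSpace.norm_sq_eq]
  rw [← Fintype.sum_subtype_add_sum_subtype (fun j : Fin k => (j : ℕ) < k₀)]
  congr 1
  exact Fintype.sum_equiv (Equiv.subtypeEquivRight fun j => not_lt) _ _ fun _ => rfl

theorem norm_slow_le (g : EuclideanSpace ℝ (Fin k)) : ‖slow k₀ g‖ ≤ ‖g‖ := by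
  have := norm_sq_eq_slow_add_fast k₀ g
  exact abs_le_of_sq_le_sq' (by nlinarith [sq_nonneg ‖fast k₀ g‖]) (norm_nonneg _) |>.2

theorem measurable_slow : Measurable (slow (k := k) k₀) := by
  unfold slow; fun_prop

theorem measurable_fast : Measurable (fast (k := k) k₀) := by
  unfold fast; fun_prop

end SlowFast

theorem norm_fast_le_mul {k : ℕ} (k₀ : ℕ) (g : EuclideanSpace ℝ (Fin k)) {s : ℝ} (hs : 0 ≤ s)
    (h : ∀ j : FastIdx k k₀, |g j.1| ≤ s) : ‖fast k₀ g‖ ≤ k * s := by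
  have hcard : (Fintype.card (FastIdx k k₀) : ℝ) ≤ k := by
    exact_mod_cast (Fintype.card_subtype_le _).trans_eq (Fintype.card_fin k)
  refine abs_le_of_sq_le_sq' ?_ (by positivity) |>.2
  rw [EuclideanSpace.norm_sq_eq]
  calc ∑ i, ‖fast k₀ g i‖ ^ 2 ≤ ∑ _i : FastIdx k k₀, s ^ 2 := by
        gcongr with i
        exact h i
    _ = Fintype.card (FastIdx k k₀) * s ^ 2 := by simp
    _ ≤ k * s ^ 2 := by gcongr
    _ ≤ (k * s) ^ 2 := by
        rcases Nat.eq_zero_or_pos k with rfl | hk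
        · simp
        · have : (1 : ℝ) ≤ k := by exact_mod_cast hk
          rw [mul_pow]
          have : (k : ℝ) ≤ k ^ 2 := by nlinarith
          gcongr

/-- A differentiable map with injective derivative at `θ₀` which separates `θ₀` from the points
away from it grows at least linearly near `θ₀`, and stays bounded below further away. -/
theorem exists_mul_min_le_norm_sub {d : ℕ} {F : Type*} [NormedAddCommGroup F] [NormedSpace ℝ F]
    {f : EuclideanSpace ℝ (Fin d) → F} {θ₀ : EuclideanSpace ℝ (Fin d)}
    {Θ : Set (EuclideanSpace ℝ (Fin d))}
    {B : EuclideanSpace ℝ (Fin d) →L[ℝ] F} (hf : HasFDerivAt f B θ₀)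
    {c : ℝ} (hc : 0 < c) (hB : ∀ x, c * ‖x‖ ≤ ‖B x‖)
    (hid : ∀ r : ℝ, 0 < r → ∃ a : ℝ, 0 < a ∧ ∀ θ ∈ Θ, r ≤ ‖θ - θ₀‖ → a ≤ ‖f θ - f θ₀‖)
    {r₁ : ℝ} (hr₁ : 0 < r₁) :
    ∃ c₀ : ℝ, 0 < c₀ ∧ ∀ θ ∈ Θ, c₀ * min ‖θ - θ₀‖ r₁ ≤ ‖f θ - f θ₀‖ := by
  have h1 := (hasFDerivAt_iff_isLittleO.1 hf).def (half_pos hc)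
  obtain ⟨r, hr, hball⟩ := Metric.eventually_nhds_iff.1 h1
  obtain ⟨a, ha, hfar⟩ := hid r hr
  refine ⟨min (c / 2) (a / r₁), by positivity, fun θ hθ => ?_⟩
  rcases lt_or_ge ‖θ - θ₀‖ r with hlt | hge
  · have h2 := hball (by rwa [dist_eq_norm])
    have h3 : ‖B (θ - θ₀)‖ ≤ ‖f θ - f θ₀‖ + ‖f θ - f θ₀ - B (θ - θ₀)‖ := by
      have := norm_sub_le (f θ - f θ₀) (f θ - f θ₀ - B (θ - θ₀))
      simpa using this
    have h4 := hB (θ - θ₀)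
    calc min (c / 2) (a / r₁) * min ‖θ - θ₀‖ r₁ ≤ c / 2 * ‖θ - θ₀‖ := by
          gcongr
          · exact min_le_left _ _
          · exact min_le_left _ _
      _ ≤ _ := by linarith
  · calc min (c / 2) (a / r₁) * min ‖θ - θ₀‖ r₁ ≤ a / r₁ * r₁ := by
          gcongr
          · exact min_le_right _ _
          · exact min_le_right _ _
      _ = a := by field_simp
      _ ≤ _ := hfar θ hθ hge

/-! ### The proxy event and its sandwich between slow balls -/

section Proxy

variable {Ω : Type*} {k : ℕ}

/-- The event that the summary statistic of `z` is within `ε` of `S`, except that the distance of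
the fast components is replaced by `‖fast (t - t₀)‖` whenever one of them is further than `τ`
from that of `t`. -/
def proxyEvent (η : Ω → EuclideanSpace ℝ (Fin k)) (k₀ : ℕ) (ε τ : ℝ)
    (S t t₀ : EuclideanSpace ℝ (Fin k)) : Set Ω :=
  {z | ((∀ j : FastIdx k k₀, |η z j.1 - t j.1| ≤ τ) ∧ ‖S - η z‖ ≤ ε) ∨
    ((¬ ∀ j : FastIdx k k₀, |η z j.1 - t j.1| ≤ τ) ∧
      ‖slow k₀ (S - η z)‖ ^ 2 + ‖fast k₀ (t - t₀)‖ ^ 2 ≤ ε ^ 2)}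

/-- The event that the slow components of the summary statistic of `z` are within `ε` of those of
`S`, while a fast one deviates by more than `τ` from that of `t`. -/
def deviationEvent (η : Ω → EuclideanSpace ℝ (Fin k)) (k₀ : ℕ) (ε τ : ℝ)
    (S t : EuclideanSpace ℝ (Fin k)) : Set Ω :=
  {z | ‖slow k₀ (S - η z)‖ ≤ ε ∧ ∃ j : FastIdx k k₀, τ < |η z j.1 - t j.1|}

variable {η : Ω → EuclideanSpace ℝ (Fin k)} {k₀ : ℕ} {ε τ : ℝ}
  {S t t₀ : EuclideanSpace ℝ (Fin k)}

theorem proxyEvent_subset (hε : 0 < ε) :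
    proxyEvent η k₀ ε τ S t t₀ ⊆ {z | ‖slow k₀ (S - η z)‖ ≤ ε} := by
  rintro z (⟨-, h⟩ | ⟨-, h⟩)
  · exact (norm_slow_le k₀ _).trans h
  · exact abs_le_of_sq_le_sq' (by nlinarith [sq_nonneg ‖fast k₀ (t - t₀)‖]) hε.le |>.2

/-- The two events agree when no fast component deviates, and each of them forces the slow distance
to be at most `ε`; their symmetric difference thus lies in the deviation event. -/
theorem abs_real_sub_proxyEvent_le [MeasurableSpace Ω] (μ : Measure Ω) [IsFiniteMeasure μ] (hε : 0 < ε) :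
    |μ.real {z | ‖S - η z‖ ≤ ε} - μ.real (proxyEvent η k₀ ε τ S t t₀)|
      ≤ μ.real (deviationEvent η k₀ ε τ S t) := by
  have h1 : {z | ‖S - η z‖ ≤ ε} ⊆ proxyEvent η k₀ ε τ S t t₀ ∪ deviationEvent η k₀ ε τ S t := by
    intro z hz
    by_cases hg : ∀ j : FastIdx k k₀, |η z j.1 - t j.1| ≤ τ
    · exact Or.inl (Or.inl ⟨hg, hz⟩)
    · exact Or.inr ⟨(norm_slow_le k₀ _).trans hz, by simpa using hg⟩
  have h2 : proxyEvent η k₀ ε τ S t t₀ ⊆ {z | ‖S - η z‖ ≤ ε} ∪ deviationEvent η k₀ ε τ S t := by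
    intro z hz
    by_cases hg : ∀ j : FastIdx k k₀, |η z j.1 - t j.1| ≤ τ
    · rcases hz with h | h
      · exact Or.inl h.2
      · exact absurd hg h.1
    · exact Or.inr ⟨proxyEvent_subset hε hz, by simpa using hg⟩
  have h3 := (measureReal_mono (μ := μ) h1).trans (measureReal_union_le _ _)
  have h4 := (measureReal_mono (μ := μ) h2).trans (measureReal_union_le _ _)
  rw [abs_le]
  constructor <;> linarith

/-- Up to sign, the two fast vectors differ by the noise `s - t` of the simulation and the noise `S
- t₀` of the observation. -/
theorem abs_norm_fast_sub_norm_fast_le (hτ : 0 ≤ τ) {s : EuclideanSpace ℝ (Fin k)}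
    (h : ∀ j : FastIdx k k₀, |s j.1 - t j.1| ≤ τ) :
    |‖fast k₀ (S - s)‖ - ‖fast k₀ (t - t₀)‖| ≤ k * τ + ‖fast k₀ (S - t₀)‖ := by
  have h1 : ‖fast k₀ (s - t)‖ ≤ k * τ := norm_fast_le_mul k₀ _ hτ fun j => h j
  rw [← norm_neg (fast k₀ (t - t₀))]
  refine (abs_norm_sub_norm_le _ _).trans ?_
  have h2 : fast k₀ (S - s) - -fast k₀ (t - t₀) = fast k₀ (S - t₀) - fast k₀ (s - t) := by
    simp only [fast_sub]; abel
  rw [h2]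
  exact (norm_sub_le _ _).trans (by linarith)

variable {e : ℝ}

/-- Inner half of the sandwich: enlarging the deterministic fast distance by the error `e` covers
both branches of the proxy, so a condition on the slow statistics alone suffices. -/
theorem subset_proxyEvent (hτ : 0 ≤ τ) (hε : 0 < ε) (he : k * τ + ‖fast k₀ (S - t₀)‖ ≤ e)
    {s : ℝ} (h : s ^ 2 + (‖fast k₀ (t - t₀)‖ + e) ^ 2 ≤ ε ^ 2) :
    {z | ‖slow k₀ (S - η z)‖ < s} ⊆ proxyEvent η k₀ ε τ S t t₀ := by
  intro z (hz : _ < s)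
  have h0 : 0 ≤ e := le_trans (by positivity) he
  have h1 : ‖slow k₀ (S - η z)‖ ^ 2 ≤ s ^ 2 := by gcongr
  by_cases hg : ∀ j : FastIdx k k₀, |η z j.1 - t j.1| ≤ τ
  · refine Or.inl ⟨hg, ?_⟩
    have h2 := (abs_le.1 ((abs_norm_fast_sub_norm_fast_le (S := S) (t₀ := t₀) hτ hg).trans he)).2
    have h3 : ‖fast k₀ (S - η z)‖ ^ 2 ≤ (‖fast k₀ (t - t₀)‖ + e) ^ 2 := by
      gcongr; linarith
    refine abs_le_of_sq_le_sq' ?_ hε.le |>.2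
    rw [norm_sq_eq_slow_add_fast k₀]
    linarith
  · refine Or.inr ⟨hg, ?_⟩
    have h3 : ‖fast k₀ (t - t₀)‖ ^ 2 ≤ (‖fast k₀ (t - t₀)‖ + e) ^ 2 := by
      gcongr; linarith
    linarith

/-- Outer half of the sandwich. The fast distance is diminished by `e`, and `her` keeps the
difference nonnegative so that it can be squared. -/
theorem proxyEvent_subset_of_lt (hτ : 0 ≤ τ)
    (he : k * τ + ‖fast k₀ (S - t₀)‖ ≤ e) (her : e ≤ ‖fast k₀ (t - t₀)‖)
    {s : ℝ} (hs : 0 ≤ s) (h : ε ^ 2 < s ^ 2 + (‖fast k₀ (t - t₀)‖ - e) ^ 2) :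
    proxyEvent η k₀ ε τ S t t₀ ⊆ {z | ‖slow k₀ (S - η z)‖ < s} := by
  intro z hz
  have h0 : 0 ≤ e := le_trans (by positivity) he
  refine lt_of_pow_lt_pow_left₀ 2 hs ?_
  rcases hz with ⟨hg, hz⟩ | ⟨-, hz⟩
  · have h2 := (abs_le.1 ((abs_norm_fast_sub_norm_fast_le (S := S) (t₀ := t₀) hτ hg).trans he)).1
    have h3 : (‖fast k₀ (t - t₀)‖ - e) ^ 2 ≤ ‖fast k₀ (S - η z)‖ ^ 2 := by
      gcongr
      linarith
    have h4 : ‖S - η z‖ ^ 2 ≤ ε ^ 2 := by gcongr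
    rw [norm_sq_eq_slow_add_fast k₀] at h4
    linarith
  · have h3 : (‖fast k₀ (t - t₀)‖ - e) ^ 2 ≤ ‖fast k₀ (t - t₀)‖ ^ 2 := by
      gcongr
      linarith
    linarith

/-- This is the outer inclusion with slow radius `0`: the fast distance alone already exceeds `ε`.
-/
theorem proxyEvent_eq_empty (hτ : 0 ≤ τ) (hε : 0 < ε)
    (he : k * τ + ‖fast k₀ (S - t₀)‖ ≤ e) (h : ε < ‖fast k₀ (t - t₀)‖ - e) :
    proxyEvent η k₀ ε τ S t t₀ = ∅ := by
  have := proxyEvent_subset_of_lt (η := η) (ε := ε) hτ he (by linarith) le_rfl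
    (by rw [zero_pow two_ne_zero, zero_add]; gcongr)
  refine Set.subset_empty_iff.1 (this.trans fun z hz => ?_)
  exact absurd (norm_nonneg _) (not_le.2 hz)

end Proxy

/-! ### Small balls of the slow statistics -/

section Scale

variable {k k₀ : ℕ}

/-- Componentwise scaling of a vector of slow components. -/
def slowScale (v : Fin k → ℝ) (u : EuclideanSpace ℝ (SlowIdx k k₀)) :
    EuclideanSpace ℝ (SlowIdx k k₀) :=
  WithLp.toLp 2 (fun j => v j.1 * u j)

theorem slowScale_add (v : Fin k → ℝ) (u w : EuclideanSpace ℝ (SlowIdx k k₀)) :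
    slowScale v (u + w) = slowScale v u + slowScale v w := by
  ext j; simp [slowScale, mul_add]

theorem norm_slowScale_le {v : Fin k → ℝ} {V : ℝ} (hV : 0 ≤ V)
    (h : ∀ j : SlowIdx k k₀, |v j.1| ≤ V)
    (u : EuclideanSpace ℝ (SlowIdx k k₀)) : ‖slowScale v u‖ ≤ V * ‖u‖ := by
  refine abs_le_of_sq_le_sq' ?_ (by positivity) |>.2
  rw [mul_pow, EuclideanSpace.norm_sq_eq, EuclideanSpace.norm_sq_eq, Finset.mul_sum]
  refine Finset.sum_le_sum fun j _ => ?_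
  simp only [slowScale, norm_mul, mul_pow, Real.norm_eq_abs]
  gcongr
  exact h j

theorem norm_slowScale_le_sum (v : Fin k → ℝ) (u : EuclideanSpace ℝ (SlowIdx k k₀)) :
    ‖slowScale v u‖ ≤ ∑ j : SlowIdx k k₀, |v j.1 * u j| := by
  refine abs_le_of_sq_le_sq' ?_ (Finset.sum_nonneg fun _ _ => abs_nonneg _) |>.2
  rw [EuclideanSpace.norm_sq_eq]
  exact Finset.sum_sq_le_sq_sum_of_nonneg fun _ _ => abs_nonneg _

@[fun_prop]
theorem continuous_slowScale (v : Fin k → ℝ) :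
    Continuous (slowScale (k₀ := k₀) v) := by
  unfold slowScale; fun_prop

end Scale

/-- The assumptions on the probabilities of small balls for the slow statistics. -/
structure SmallBallAsymptotics {Ω : ℕ → Type*} [∀ n, MeasurableSpace (Ω n)] {d k k₀ : ℕ}
    (P : (n : ℕ) → Kernel (EuclideanSpace ℝ (Fin d)) (Ω n))
    (η : (n : ℕ) → Ω n → EuclideanSpace ℝ (Fin k)) (ε : ℕ → ℝ) (v : ℕ → Fin k → ℝ)
    (b : EuclideanSpace ℝ (Fin d) → EuclideanSpace ℝ (Fin k)) (θ₀ : EuclideanSpace ℝ (Fin d))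
    (δ R : ℝ) (γ : EuclideanSpace ℝ (SlowIdx k k₀) → ℝ) (L : ℕ → ℝ) : Prop where
  eps_pos : ∀ n, 1 ≤ n → 0 < ε n
  eps_tendsto : Tendsto ε atTop (𝓝 0)
  rate_pos : ∀ n, 1 ≤ n → ∀ j, 0 < v n j
  rate_slow : ∀ j : SlowIdx k k₀, Tendsto (fun n => v n j.1 * ε n) atTop (𝓝 0)
  lipschitz : ∃ C : ℝ≥0, LipschitzWith C b
  radius_pos : 0 < δ
  exponent_nonneg : 0 ≤ R
  density_pos : ∀ m, 0 < γ m
  density_bdd : ∃ C : ℝ, ∀ m, γ m ≤ C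
  density_lipschitz : ∃ C : ℝ≥0, LipschitzWith C γ
  ball : ∀ K : Set (EuclideanSpace ℝ (SlowIdx k k₀)), IsCompact K → ∀ t : ℝ, 0 < t → t ≤ 1 →
    TendstoUniformlyOn
      (fun n (p : EuclideanSpace ℝ (Fin d) × EuclideanSpace ℝ (SlowIdx k k₀)) =>
        (P n p.1).real {z | ∑ j : SlowIdx k k₀,
            (normalised (v n) (b p.1) (η n z) j.1 - p.2 j) ^ 2 / v n j.1 ^ 2 < t ^ 2 * ε n ^ 2}
          / (t ^ R * L n))
      (fun p => γ p.2) atTop (Metric.ball θ₀ δ ×ˢ K)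

namespace SmallBallAsymptotics

variable {Ω : ℕ → Type*} [∀ n, MeasurableSpace (Ω n)] {d k k₀ : ℕ}
  {P : (n : ℕ) → Kernel (EuclideanSpace ℝ (Fin d)) (Ω n)}
  {η : (n : ℕ) → Ω n → EuclideanSpace ℝ (Fin k)} {ε : ℕ → ℝ} {v : ℕ → Fin k → ℝ}
  {b : EuclideanSpace ℝ (Fin d) → EuclideanSpace ℝ (Fin k)} {θ₀ : EuclideanSpace ℝ (Fin d)}
  {δ R : ℝ} {γ : EuclideanSpace ℝ (SlowIdx k k₀) → ℝ} {L : ℕ → ℝ}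
  (H : SmallBallAsymptotics P η ε v b θ₀ δ R γ L)

/-- With `m` the scaled value of `w - slow k₀ (b θ)`, the weights `v` cancel and the weighted sum is
the plain Euclidean distance from `w`. -/
theorem eventually_abs_sub_lt (H : SmallBallAsymptotics P η ε v b θ₀ δ R γ L)
    (M : ℝ) {t : ℝ} (ht : 0 < t) (ht1 : t ≤ 1) {e : ℝ} (he : 0 < e) :
    ∀ᶠ n in atTop, ∀ θ ∈ Metric.ball θ₀ δ, ∀ w : EuclideanSpace ℝ (SlowIdx k k₀),
      ‖slowScale (v n) (w - slow k₀ (b θ))‖ ≤ M →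
        |(P n θ).real {z | ‖w - slow k₀ (η n z)‖ < t * ε n} / (t ^ R * L n)
          - γ (slowScale (v n) (w - slow k₀ (b θ)))| < e := by
  have h := Metric.tendstoUniformlyOn_iff.1
    (H.ball (Metric.closedBall 0 M) (isCompact_closedBall _ _) t ht ht1) e he
  filter_upwards [h, eventually_ge_atTop 1] with n hn hn1 θ hθ w hw
  have h1 := hn (θ, slowScale (v n) (w - slow k₀ (b θ))) ⟨hθ, by simpa using hw⟩
  rw [dist_comm, Real.dist_eq] at h1
  convert h1 using 7 with z
  simp only
  have h2 : ∑ j : SlowIdx k k₀, (normalised (v n) (b θ) (η n z) j.1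
      - slowScale (v n) (w - slow k₀ (b θ)) j) ^ 2 / v n j.1 ^ 2 = ‖w - slow k₀ (η n z)‖ ^ 2 := by
    rw [EuclideanSpace.norm_sq_eq]
    refine Finset.sum_congr rfl fun j _ => ?_
    have hv := (H.rate_pos n hn1 j.1).ne'
    simp only [normalised, slowScale, slow, PiLp.sub_apply, Real.norm_eq_abs, sq_abs]
    field_simp
    ring
  rw [h2, ← mul_pow]
  have hε := H.eps_pos n hn1
  exact ⟨fun h => by gcongr, fun h => lt_of_pow_lt_pow_left₀ 2 (by positivity) h⟩

/-- A probability divided by `L n` comes within `γ 0` of `γ 0 > 0`, so it is positive and `L n` must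
be too. -/
theorem eventually_pos (H : SmallBallAsymptotics P η ε v b θ₀ δ R γ L) :
    ∀ᶠ n in atTop, 0 < L n := by
  filter_upwards [H.eventually_abs_sub_lt 0 one_pos le_rfl (H.density_pos 0)] with n hn
  have h := hn θ₀ (Metric.mem_ball_self H.radius_pos) (slow k₀ (b θ₀))
  have h0 : slowScale (v n) (0 : EuclideanSpace ℝ (SlowIdx k k₀)) = 0 := by
    ext; simp [slowScale]
  rw [sub_self, h0, norm_zero, Real.one_rpow, one_mul, one_mul] at h
  have h1 := (abs_lt.1 (h le_rfl)).1
  by_contra hL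
  have := div_nonpos_of_nonneg_of_nonpos
    (measureReal_nonneg (μ := P n θ₀) (s := {z | ‖slow k₀ (b θ₀) - slow k₀ (η n z)‖ < ε n}))
    (not_lt.1 hL)
  linarith

/-- Slow rates satisfy `v ε → 0`: shifts of order `ε n` disappear after scaling. -/
theorem eventually_norm_slowScale_le (H : SmallBallAsymptotics P η ε v b θ₀ δ R γ L)
    {A e : ℝ} (hA : 0 < A) (he : 0 < e) :
    ∀ᶠ n in atTop, ∀ u : EuclideanSpace ℝ (SlowIdx k k₀), ‖u‖ ≤ A * ε n →
      ‖slowScale (v n) u‖ ≤ e := by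
  have h : ∀ᶠ n in atTop, ∀ j : SlowIdx k k₀, v n j.1 * ε n < e / A :=
    eventually_all.2 fun j => (H.rate_slow j).eventually_lt_const (by positivity)
  filter_upwards [h, eventually_ge_atTop 1] with n hn hn1 u hu
  have hε := H.eps_pos n hn1
  calc ‖slowScale (v n) u‖ ≤ e / A / ε n * ‖u‖ := by
        refine norm_slowScale_le (by positivity) (fun j => ?_) u
        rw [abs_of_pos (H.rate_pos n hn1 _), le_div_iff₀ hε]
        exact (hn j).le
    _ ≤ e / A / ε n * (A * ε n) := by gcongr
    _ = e := by field_simp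

/-- Closed balls of radius `ε n` for the slow statistics have probability of order at most
`L n`. -/
theorem exists_eventually_real_le [∀ n, IsMarkovKernel (P n)]
    (H : SmallBallAsymptotics P η ε v b θ₀ δ R γ L) (M : ℝ) :
    ∃ C : ℝ, 0 < C ∧ ∀ᶠ n in atTop, ∀ θ ∈ Metric.ball θ₀ δ,
      ∀ w : EuclideanSpace ℝ (SlowIdx k k₀), ‖slowScale (v n) (w - slow k₀ (b θ))‖ ≤ M →
        (P n θ).real {z | ‖w - slow k₀ (η n z)‖ ≤ ε n} ≤ C * L n := by
  obtain ⟨G, hG⟩ := H.density_bdd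
  have hG0 : 0 < G := (H.density_pos 0).trans_le (hG 0)
  obtain ⟨T, hT, hTfin, hcover⟩ := finite_cover_balls_of_compact
    (isCompact_closedBall (0 : EuclideanSpace ℝ (SlowIdx k k₀)) 1) one_pos
  lift T to Finset (EuclideanSpace ℝ (SlowIdx k k₀)) using hTfin
  -- The hypothesis concerns open balls, so the closed unit ball is covered by finitely many open
  -- unit balls and the cover is rescaled by `ε n`. The final `+ 1` only makes the constant visibly
  -- positive.
  refine ⟨T.card * (G + 1) + 1, by positivity, ?_⟩
  filter_upwards [H.eventually_abs_sub_lt (M + 1) one_pos le_rfl one_pos, H.eventually_pos,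
    H.eventually_norm_slowScale_le one_pos one_pos, eventually_ge_atTop 1]
    with n hn hL hs hn1 θ hθ w hw
  have hε := H.eps_pos n hn1
  have hsub : {z | ‖w - slow k₀ (η n z)‖ ≤ ε n} ⊆
      ⋃ u ∈ T, {z | ‖w - ε n • u - slow k₀ (η n z)‖ < 1 * ε n} := by
    intro z hz
    have h1 : (ε n)⁻¹ • (w - slow k₀ (η n z)) ∈
        Metric.closedBall (0 : EuclideanSpace ℝ (SlowIdx k k₀)) 1 := by
      rw [mem_closedBall_zero_iff, norm_smul, norm_inv, Real.norm_of_nonneg hε.le,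
        inv_mul_le_iff₀ hε, mul_one]
      exact hz
    obtain ⟨u, hu, huz⟩ := Set.mem_iUnion₂.1 (hcover h1)
    refine Set.mem_iUnion₂.2 ⟨u, hu, ?_⟩
    rw [Metric.mem_ball, dist_eq_norm] at huz
    have h2 : w - ε n • u - slow k₀ (η n z)
        = ε n • ((ε n)⁻¹ • (w - slow k₀ (η n z)) - u) := by
      rw [smul_sub, smul_inv_smul₀ hε.ne']; abel
    rw [Set.mem_ofPred_eq, h2, norm_smul, Real.norm_of_nonneg hε.le, mul_comm]
    gcongr
  have hone : ∀ u ∈ T, (P n θ).real {z | ‖w - ε n • u - slow k₀ (η n z)‖ < 1 * ε n}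
      ≤ (G + 1) * L n := by
    intro u hu
    have hu1 : ‖-(ε n • u)‖ ≤ 1 * ε n := by
      rw [norm_neg, norm_smul, Real.norm_of_nonneg hε.le, one_mul]
      have := mem_closedBall_zero_iff.1 (hT hu)
      nlinarith
    -- Recentring the ball by `ε n • u` moves the scaled centre by at most `1`, hence the compact of
    -- radius `M + 1`.
    have h1 : ‖slowScale (v n) (w - ε n • u - slow k₀ (b θ))‖ ≤ M + 1 := by
      have : w - ε n • u - slow k₀ (b θ) = (w - slow k₀ (b θ)) + -(ε n • u) := by abel
      rw [this, slowScale_add]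
      exact (norm_add_le _ _).trans (add_le_add hw (hs _ hu1))
    have h2 := (abs_lt.1 (hn θ hθ (w - ε n • u) h1)).2
    have h3 := hG (slowScale (v n) (w - ε n • u - slow k₀ (b θ)))
    rw [← div_le_iff₀ hL]
    rw [Real.one_rpow, one_mul (L n)] at h2
    linarith
  calc (P n θ).real {z | ‖w - slow k₀ (η n z)‖ ≤ ε n}
      ≤ (P n θ).real (⋃ u ∈ T, {z | ‖w - ε n • u - slow k₀ (η n z)‖ < 1 * ε n}) :=
        measureReal_mono hsub (measure_ne_top _ _)
    _ ≤ ∑ u ∈ T, (P n θ).real {z | ‖w - ε n • u - slow k₀ (η n z)‖ < 1 * ε n} :=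
        measureReal_biUnion_finset_le _ _
    _ ≤ ∑ _u ∈ T, (G + 1) * L n := Finset.sum_le_sum hone
    _ = T.card * (G + 1) * L n := by rw [Finset.sum_const, nsmul_eq_mul, mul_assoc]
    _ ≤ (T.card * (G + 1) + 1) * L n := by gcongr; linarith

theorem exists_le_density (H : SmallBallAsymptotics P η ε v b θ₀ δ R γ L) (M : ℝ) :
    ∃ g : ℝ, 0 < g ∧ ∀ m, ‖m‖ ≤ M → g ≤ γ m := by
  obtain ⟨C, hC⟩ := H.density_lipschitz
  rcases lt_or_ge M 0 with hM | hM
  · exact ⟨1, one_pos, fun m hm => absurd (norm_nonneg m) (by linarith)⟩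
  obtain ⟨m₀, -, hm₀⟩ := (isCompact_closedBall (0 : EuclideanSpace ℝ (SlowIdx k k₀)) M).exists_isMinOn
    ⟨0, by simpa using hM⟩ hC.continuous.continuousOn
  exact ⟨γ m₀, H.density_pos _, fun m hm => hm₀ (by simpa using hm)⟩

end SmallBallAsymptotics

/-! ### Joint measurability in the parameter and the data -/

section Measurability

variable {Ω : Type*} [MeasurableSpace Ω] {k : ℕ} {α : Type*} [MeasurableSpace α]
  {η : Ω → EuclideanSpace ℝ (Fin k)} {k₀ : ℕ} {ε : ℝ} {τ : α → ℝ}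
  {S t : α → EuclideanSpace ℝ (Fin k)}

theorem measurableSet_fast_deviation (hη : Measurable η) (hτ : Measurable τ) (ht : Measurable t)
    (j : Fin k) : MeasurableSet {p : α × Ω | |η p.2 j - t p.1 j| ≤ τ p.1} := by
  refine measurableSet_le ?_ (by fun_prop)
  have h1 : Measurable fun p : α × Ω => η p.2 - t p.1 := by fun_prop
  have h2 : Measurable fun p : α × Ω => (η p.2 - t p.1) j := by fun_prop
  exact measurable_norm.comp h2

theorem measurableSet_proxyEvent (hη : Measurable η) (hτ : Measurable τ) (hS : Measurable S)
    (ht : Measurable t) (t₀ : EuclideanSpace ℝ (Fin k)) :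
    MeasurableSet {p : α × Ω | p.2 ∈ proxyEvent η k₀ ε (τ p.1) (S p.1) (t p.1) t₀} := by
  have h1 : MeasurableSet {p : α × Ω | ∀ j : FastIdx k k₀, |η p.2 j.1 - t p.1 j.1| ≤ τ p.1} := by
    simp only [Set.ofPred_forall]
    exact MeasurableSet.iInter fun j => measurableSet_fast_deviation hη hτ ht j.1
  have h2 : Measurable fun p : α × Ω => S p.1 - η p.2 := by fun_prop
  have h3 : Measurable fun p : α × Ω => t p.1 - t₀ := by fun_prop
  exact (h1.inter (measurableSet_le h2.norm measurable_const)).union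
    (h1.compl.inter (measurableSet_le
      ((((measurable_slow k₀).comp h2).norm.pow_const 2).add
        (((measurable_fast k₀).comp h3).norm.pow_const 2)) measurable_const))

theorem measurableSet_deviationEvent (hη : Measurable η) (hτ : Measurable τ) (hS : Measurable S)
    (ht : Measurable t) :
    MeasurableSet {p : α × Ω | p.2 ∈ deviationEvent η k₀ ε (τ p.1) (S p.1) (t p.1)} := by
  have h1 : MeasurableSet {p : α × Ω | ∃ j : FastIdx k k₀, τ p.1 < |η p.2 j.1 - t p.1 j.1|} := by
    simp only [Set.ofPred_exists]
    refine MeasurableSet.iUnion fun j => ?_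
    simpa [Set.compl_def] using (measurableSet_fast_deviation hη hτ ht j.1).compl
  have h2 : Measurable fun p : α × Ω => S p.1 - η p.2 := by fun_prop
  exact (measurableSet_le ((measurable_slow k₀).comp h2).norm measurable_const).inter h1

theorem measurable_kernel_real {P : Kernel α Ω} [IsMarkovKernel P] {s : Set (α × Ω)}
    (hs : MeasurableSet s) : Measurable fun a => (P a).real {z | (a, z) ∈ s} :=
  (Kernel.measurable_kernel_prodMk_left hs).ennreal_toReal

end Measurability

/-! ### Null boundary, local linearisation and typical observations -/

/-- The set lies in the frontier of a convex set, which is Lebesgue null. No point of it is interior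
to `‖B x‖ ≤ 1`, since a slight outward dilation leaves that set. -/
theorem volume_norm_map_eq_one {d : ℕ} {F : Type*} [NormedAddCommGroup F] [NormedSpace ℝ F]
    (B : EuclideanSpace ℝ (Fin d) →L[ℝ] F) :
    volume {x : EuclideanSpace ℝ (Fin d) | ‖B x‖ = 1} = 0 := by
  have hconv : Convex ℝ {x : EuclideanSpace ℝ (Fin d) | ‖B x‖ ≤ 1} := by
    have : {x : EuclideanSpace ℝ (Fin d) | ‖B x‖ ≤ 1} = B ⁻¹' Metric.closedBall 0 1 := by
      ext x; simp
    rw [this]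
    exact (convex_closedBall (0 : F) 1).linear_preimage B.toLinearMap
  refine measure_mono_null (fun x (hx : ‖B x‖ = 1) => ?_) (hconv.addHaar_frontier volume)
  refine ⟨subset_closure hx.le, fun hint => ?_⟩
  have hcont : Tendsto (fun s : ℝ => (1 + s) • x) (𝓝[>] 0) (𝓝 x) := by
    have : Tendsto (fun s : ℝ => (1 + s) • x) (𝓝 0) (𝓝 ((1 + (0 : ℝ)) • x)) :=
      (by fun_prop : Continuous fun s : ℝ => (1 + s) • x).tendsto 0
    rw [add_zero, one_smul] at this
    exact this.mono_left nhdsWithin_le_nhds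
  obtain ⟨s, hs, hs0⟩ :=
    ((hcont.eventually (mem_interior_iff_mem_nhds.1 hint)).and self_mem_nhdsWithin).exists
  have h1 : ‖B ((1 + s) • x)‖ ≤ 1 := hs
  have h2 : (0 : ℝ) < s := hs0
  rw [map_smul, norm_smul, hx, Real.norm_of_nonneg (by positivity)] at h1
  linarith

theorem tendsto_norm_sub_div_of_hasFDerivAt {d : ℕ} {F : Type*} [NormedAddCommGroup F]
    [NormedSpace ℝ F] {f : EuclideanSpace ℝ (Fin d) → F} {θ₀ : EuclideanSpace ℝ (Fin d)}
    {B : EuclideanSpace ℝ (Fin d) →L[ℝ] F} (hf : HasFDerivAt f B θ₀) {ε : ℕ → ℝ}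
    (hpos : ∀ n, 1 ≤ n → 0 < ε n) (hε : Tendsto ε atTop (𝓝 0)) (x : EuclideanSpace ℝ (Fin d)) :
    Tendsto (fun n => ‖f (θ₀ + ε n • x) - f θ₀‖ / ε n) atTop (𝓝 ‖B x‖) := by
  have h0 : Tendsto ε atTop (𝓝[≠] 0) :=
    tendsto_nhdsWithin_iff.2 ⟨hε, by
      filter_upwards [eventually_ge_atTop 1] with n hn using (hpos n hn).ne'⟩
  have h := (hf.lim x (tendsto_norm_inv_nhdsNE_zero_atTop.comp h0)).norm
  refine h.congr' ?_
  filter_upwards [eventually_ge_atTop 1] with n hn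
  rw [inv_inv, norm_smul, norm_inv, Real.norm_of_nonneg (hpos n hn).le, div_eq_inv_mul]

/-- The pairs `(n, S)` of a sample size and an observed summary statistic, as `n → ∞` with the
scaled slow components of `S` bounded and the fast ones converging faster than `ε n`. -/
def typicalFilter {k : ℕ} (k₀ : ℕ) (ε : ℕ → ℝ) (v : ℕ → Fin k → ℝ) (b₀ : EuclideanSpace ℝ (Fin k))
    (M : ℝ) : Filter (ℕ × EuclideanSpace ℝ (Fin k)) :=
  comap Prod.fst atTop ⊓ 𝓟 {p | ‖slowScale (v p.1) (slow k₀ (p.2 - b₀))‖ ≤ M} ⊓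
    comap (fun p => ‖fast k₀ (p.2 - b₀)‖ / ε p.1) (𝓝 0)

section TypicalFilter

variable {k k₀ : ℕ} {ε : ℕ → ℝ} {v : ℕ → Fin k → ℝ} {b₀ : EuclideanSpace ℝ (Fin k)} {M : ℝ}

/-- Dominated convergence along a filter requires this. -/
instance : (typicalFilter k₀ ε v b₀ M).IsCountablyGenerated := by
  unfold typicalFilter; infer_instance

theorem tendsto_fst_typicalFilter : Tendsto Prod.fst (typicalFilter k₀ ε v b₀ M) atTop :=
  tendsto_comap.mono_left (inf_le_left.trans inf_le_left)

theorem eventually_norm_slowScale_le_typicalFilter :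
    ∀ᶠ p in typicalFilter k₀ ε v b₀ M, ‖slowScale (v p.1) (slow k₀ (p.2 - b₀))‖ ≤ M :=
  (inf_le_left.trans inf_le_right : typicalFilter k₀ ε v b₀ M ≤ _) (mem_principal_self _)

theorem tendsto_fast_typicalFilter :
    Tendsto (fun p => ‖fast k₀ (p.2 - b₀)‖ / ε p.1) (typicalFilter k₀ ε v b₀ M) (𝓝 0) :=
  tendsto_comap.mono_left inf_le_right

/-- Limits along the filter are uniform over typical observations; unfolding its basis recovers a
statement that can be applied to `S = η n y`. -/
theorem exists_of_eventually_typicalFilter {p : ℕ × EuclideanSpace ℝ (Fin k) → Prop}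
    (h : ∀ᶠ q in typicalFilter k₀ ε v b₀ M, p q) :
    ∃ a : ℝ, 0 < a ∧ ∀ᶠ n in atTop, ∀ S, ‖slowScale (v n) (slow k₀ (S - b₀))‖ ≤ M →
      |‖fast k₀ (S - b₀)‖ / ε n| < a → p (n, S) := by
  have hb := ((atTop_basis.comap Prod.fst).inf_principal
    {p : ℕ × EuclideanSpace ℝ (Fin k) | ‖slowScale (v p.1) (slow k₀ (p.2 - b₀))‖ ≤ M}).inf
    ((Metric.nhds_basis_ball (x := (0 : ℝ))).comap fun p : ℕ × EuclideanSpace ℝ (Fin k) =>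
      ‖fast k₀ (p.2 - b₀)‖ / ε p.1)
  obtain ⟨⟨N, a⟩, ⟨-, ha⟩, hsub⟩ := hb.eventually_iff.1 h
  refine ⟨a, ha, ?_⟩
  filter_upwards [eventually_ge_atTop N] with n hn S h1 h2
  exact hsub ⟨⟨hn, h1⟩, by
    rw [Set.mem_preimage, Metric.mem_ball, Real.dist_eq, sub_zero]; exact h2⟩

end TypicalFilter

/-- The threshold for deviations of the fast statistics at the parameter `θ`. -/
def deviationThreshold {d : ℕ} (ε ρ r₁ : ℝ) (θ₀ θ : EuclideanSpace ℝ (Fin d)) : ℝ :=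
  ρ * (ε + min ‖θ - θ₀‖ r₁)

/-! ### Pointwise limit of the rescaled proxy -/

namespace SmallBallAsymptotics

variable {Ω : ℕ → Type*} [∀ n, MeasurableSpace (Ω n)] {d k k₀ : ℕ}
  {P : (n : ℕ) → Kernel (EuclideanSpace ℝ (Fin d)) (Ω n)}
  {η : (n : ℕ) → Ω n → EuclideanSpace ℝ (Fin k)} {ε : ℕ → ℝ} {v : ℕ → Fin k → ℝ}
  {b : EuclideanSpace ℝ (Fin d) → EuclideanSpace ℝ (Fin k)} {θ₀ : EuclideanSpace ℝ (Fin d)}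
  {δ R : ℝ} {γ : EuclideanSpace ℝ (SlowIdx k k₀) → ℝ} {L : ℕ → ℝ}

theorem eventually_add_smul_mem_ball (H : SmallBallAsymptotics P η ε v b θ₀ δ R γ L)
    {A : ℝ} (hA : 0 < A) {r : ℝ} (hr : 0 < r) :
    ∀ᶠ n in atTop, ∀ x, ‖x‖ ≤ A → θ₀ + ε n • x ∈ Metric.ball θ₀ r := by
  filter_upwards [H.eps_tendsto.eventually_lt_const (div_pos hr hA), eventually_ge_atTop 1]
    with n hn hn1 x hx
  have hε := H.eps_pos n hn1
  rw [mem_ball_iff_norm, add_sub_cancel_left, norm_smul, Real.norm_of_nonneg hε.le]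
  calc ε n * ‖x‖ ≤ ε n * A := by gcongr
    _ < r := by rwa [← lt_div_iff₀ hA]

theorem eventually_norm_slowScale_sub_le (H : SmallBallAsymptotics P η ε v b θ₀ δ R γ L)
    {A : ℝ} (hA : 0 < A) {e : ℝ} (he : 0 < e) :
    ∀ᶠ n in atTop, ∀ x, ‖x‖ ≤ A →
      ‖slowScale (v n) (slow k₀ (b θ₀ - b (θ₀ + ε n • x)))‖ ≤ e := by
  obtain ⟨C, hC⟩ := H.lipschitz
  filter_upwards [H.eventually_norm_slowScale_le (A := (C + 1) * A) (by positivity) he,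
    eventually_ge_atTop 1] with n hn hn1 x hx
  refine hn _ ((norm_slow_le k₀ _).trans ?_)
  have hε := H.eps_pos n hn1
  have h1 := hC.dist_le_mul θ₀ (θ₀ + ε n • x)
  rw [dist_eq_norm, dist_eq_norm, sub_add_cancel_left, norm_neg, norm_smul,
    Real.norm_of_nonneg hε.le] at h1
  calc _ ≤ C * (ε n * ‖x‖) := h1
    _ ≤ (C + 1) * (ε n * A) := by gcongr; linarith
    _ = _ := by ring

/-- Passing from `b (θ₀ + ε x)` to `b θ₀` changes the scaled centre by `o(1)`, and `γ` is Lipschitz.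
The lower bound of `γ` on bounded sets turns the absolute error into a relative one. -/
theorem tendsto_real_ball_div (H : SmallBallAsymptotics P η ε v b θ₀ δ R γ L) (M : ℝ)
    (x : EuclideanSpace ℝ (Fin d)) {t : ℝ} (ht : 0 < t) (ht1 : t ≤ 1) :
    Tendsto (fun p : ℕ × EuclideanSpace ℝ (Fin k) =>
      (P p.1 (θ₀ + ε p.1 • x)).real {z | ‖slow k₀ (p.2 - η p.1 z)‖ < t * ε p.1} /
        (L p.1 * γ (slowScale (v p.1) (slow k₀ (p.2 - b θ₀)))))
      (typicalFilter k₀ ε v (b θ₀) M) (𝓝 (t ^ R)) := by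
  obtain ⟨g, hg, hgγ⟩ := H.exists_le_density M
  obtain ⟨C, hC⟩ := H.density_lipschitz
  have hA : 0 < ‖x‖ + 1 := by positivity
  have key : Tendsto (fun p : ℕ × EuclideanSpace ℝ (Fin k) =>
      (P p.1 (θ₀ + ε p.1 • x)).real {z | ‖slow k₀ (p.2 - η p.1 z)‖ < t * ε p.1} /
        (t ^ R * L p.1) / γ (slowScale (v p.1) (slow k₀ (p.2 - b θ₀))))
      (typicalFilter k₀ ε v (b θ₀) M) (𝓝 1) := by
    rw [Metric.tendsto_nhds]
    intro e he
    -- Half of the error `e * g` is for the small-ball limit and less than half for the change of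
    -- centre. `C + 1` avoids dividing by zero, and the minimum with `1` keeps the centre in the
    -- ball of radius `M + 1`.
    have he1 : 0 < e * g / 2 := by positivity
    have he2 : 0 < min 1 (e * g / (4 * (C + 1))) := by positivity
    filter_upwards [eventually_norm_slowScale_le_typicalFilter,
      tendsto_fst_typicalFilter.eventually (H.eventually_abs_sub_lt (M + 1) ht ht1 he1),
      tendsto_fst_typicalFilter.eventually (H.eventually_norm_slowScale_sub_le hA he2),
      tendsto_fst_typicalFilter.eventually (H.eventually_add_smul_mem_ball hA H.radius_pos)]
      with ⟨n, S⟩ h1 h2 h3 h4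
    simp only at h1 h2 h3 h4 ⊢
    have hx : ‖x‖ ≤ ‖x‖ + 1 := by linarith
    specialize h3 x hx
    have heq : slow k₀ S - slow k₀ (b (θ₀ + ε n • x))
        = slow k₀ (S - b θ₀) + slow k₀ (b θ₀ - b (θ₀ + ε n • x)) := by
      simp only [slow_sub]; abel
    have hadd : slowScale (v n) (slow k₀ S - slow k₀ (b (θ₀ + ε n • x)))
        = slowScale (v n) (slow k₀ (S - b θ₀))
          + slowScale (v n) (slow k₀ (b θ₀ - b (θ₀ + ε n • x))) := by
      rw [heq, slowScale_add]
    have h5 := h2 _ (h4 x hx) (slow k₀ S) (by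
      rw [hadd]
      exact (norm_add_le _ _).trans (add_le_add h1 (h3.trans (min_le_left _ _))))
    have h6 := hC.dist_le_mul (slowScale (v n) (slow k₀ S - slow k₀ (b (θ₀ + ε n • x))))
      (slowScale (v n) (slow k₀ (S - b θ₀)))
    rw [Real.dist_eq, dist_eq_norm, hadd, add_sub_cancel_left, ← hadd] at h6
    have h7 : (C : ℝ) * ‖slowScale (v n) (slow k₀ (b θ₀ - b (θ₀ + ε n • x)))‖ < e * g / 2 := by
      calc (C : ℝ) * ‖slowScale (v n) (slow k₀ (b θ₀ - b (θ₀ + ε n • x)))‖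
          ≤ (C + 1) * (e * g / (4 * (C + 1))) := by
            gcongr
            · linarith
            · exact h3.trans (min_le_right _ _)
        _ = e * g / 4 := by field_simp
        _ < e * g / 2 := by linarith
    have h8 := hgγ _ h1
    have hγ := H.density_pos (slowScale (v n) (slow k₀ (S - b θ₀)))
    rw [Real.dist_eq, div_sub_one hγ.ne', abs_div, abs_of_pos hγ, div_lt_iff₀ hγ]
    refine (abs_sub_le _ (γ (slowScale (v n) (slow k₀ S - slow k₀ (b (θ₀ + ε n • x))))) _).trans_lt ?_
    simp only [slow_sub] at h5 h6 h7 h8 ⊢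
    have h9 : e * g ≤ e * γ (slowScale (v n) (slow k₀ S - slow k₀ (b θ₀))) := by gcongr
    linarith
  have htR : 0 < t ^ R := Real.rpow_pos_of_pos ht R
  have := key.const_mul (t ^ R)
  rw [mul_one] at this
  refine this.congr fun p => ?_
  rw [div_div, mul_assoc, ← mul_div_assoc, mul_div_mul_left _ _ htR.ne']

variable {B : EuclideanSpace ℝ (Fin d) →L[ℝ] EuclideanSpace ℝ (FastIdx k k₀)} {ρ : ℕ → ℝ} {r₁ : ℝ}

/-- The `z`-probability of the proxy event, scaled to converge to the limiting shape. -/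
def scaledProxy (P : (n : ℕ) → Kernel (EuclideanSpace ℝ (Fin d)) (Ω n))
    (η : (n : ℕ) → Ω n → EuclideanSpace ℝ (Fin k)) (ε : ℕ → ℝ) (v : ℕ → Fin k → ℝ)
    (b : EuclideanSpace ℝ (Fin d) → EuclideanSpace ℝ (Fin k)) (θ₀ : EuclideanSpace ℝ (Fin d))
    (γ : EuclideanSpace ℝ (SlowIdx k k₀) → ℝ) (L ρ : ℕ → ℝ) (r₁ : ℝ)
    (p : ℕ × EuclideanSpace ℝ (Fin k)) (θ : EuclideanSpace ℝ (Fin d)) : ℝ :=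
  (P p.1 θ).real (proxyEvent (η p.1) k₀ (ε p.1) (deviationThreshold (ε p.1) (ρ p.1) r₁ θ₀ θ)
    p.2 (b θ) (b θ₀)) / (L p.1 * γ (slowScale (v p.1) (slow k₀ (p.2 - b θ₀))))

theorem scaledProxy_nonneg (H : SmallBallAsymptotics P η ε v b θ₀ δ R γ L)
    {p : ℕ × EuclideanSpace ℝ (Fin k)} (hL : 0 < L p.1) (θ : EuclideanSpace ℝ (Fin d)) :
    0 ≤ scaledProxy P η ε v b θ₀ γ L ρ r₁ p θ := by
  have := H.density_pos (slowScale (v p.1) (slow k₀ (p.2 - b θ₀)))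
  unfold scaledProxy
  positivity

/-- In units of `ε`, the fast distance `u` tends to `‖B x‖` and the error `e` to `0`. For `‖B x‖ <
1` the proxy is squeezed between slow balls of radii `t` just below and just above `√(1 - ‖B x‖²)`;
for `‖B x‖ > 1` it is eventually empty. -/
theorem tendsto_scaledProxy [∀ n, IsMarkovKernel (P n)]
    (H : SmallBallAsymptotics P η ε v b θ₀ δ R γ L)
    (hB : HasFDerivAt (fun θ => fast k₀ (b θ)) B θ₀) (hρ0 : ∀ n, 1 ≤ n → 0 ≤ ρ n)
    (hρ : Tendsto ρ atTop (𝓝 0)) (hr₁ : 0 ≤ r₁) (M : ℝ) {x : EuclideanSpace ℝ (Fin d)}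
    (hx0 : 0 < ‖B x‖) (hx1 : ‖B x‖ ≠ 1) :
    Tendsto (fun p => scaledProxy P η ε v b θ₀ γ L ρ r₁ p (θ₀ + ε p.1 • x))
      (typicalFilter k₀ ε v (b θ₀) M) (𝓝 (limitShape B 0 R 1 x)) := by
  set l := typicalFilter k₀ ε v (b θ₀) M with hl
  have hfst : Tendsto Prod.fst l atTop := tendsto_fst_typicalFilter
  set u : ℕ × EuclideanSpace ℝ (Fin k) → ℝ := fun p =>
    ‖fast k₀ (b (θ₀ + ε p.1 • x) - b θ₀)‖ / ε p.1 with hu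
  have hut : Tendsto u l (𝓝 ‖B x‖) :=
    (tendsto_norm_sub_div_of_hasFDerivAt hB H.eps_pos H.eps_tendsto x).comp hfst
  set e : ℕ × EuclideanSpace ℝ (Fin k) → ℝ := fun p =>
    k * (ρ p.1 * (1 + ‖x‖)) + ‖fast k₀ (p.2 - b θ₀)‖ / ε p.1 with he_def
  have het : Tendsto e l (𝓝 0) := by
    have h1 : Tendsto (fun p : ℕ × EuclideanSpace ℝ (Fin k) => (k : ℝ) * (ρ p.1 * (1 + ‖x‖))) l
        (𝓝 (k * (0 * (1 + ‖x‖)))) :=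
      ((hρ.comp hfst).mul_const _).const_mul _
    have := h1.add (tendsto_fast_typicalFilter (k₀ := k₀) (ε := ε) (v := v) (b₀ := b θ₀) (M := M))
    simpa using this
  have hbasic : ∀ᶠ p in l, 0 < ε p.1 ∧ 0 < L p.1 ∧
      0 ≤ deviationThreshold (ε p.1) (ρ p.1) r₁ θ₀ (θ₀ + ε p.1 • x) ∧
      k * deviationThreshold (ε p.1) (ρ p.1) r₁ θ₀ (θ₀ + ε p.1 • x)
        + ‖fast k₀ (p.2 - b θ₀)‖ ≤ e p * ε p.1 ∧
      ‖fast k₀ (b (θ₀ + ε p.1 • x) - b θ₀)‖ = u p * ε p.1 := by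
    filter_upwards [hfst.eventually (eventually_ge_atTop 1), hfst.eventually H.eventually_pos]
      with p hp hL
    have hε := H.eps_pos _ hp
    have hρp := hρ0 _ hp
    refine ⟨hε, hL, ?_, ?_, ?_⟩
    · unfold deviationThreshold
      positivity
    · have h1 : min ‖θ₀ + ε p.1 • x - θ₀‖ r₁ ≤ ε p.1 * ‖x‖ := by
        refine (min_le_left _ _).trans_eq ?_
        rw [add_sub_cancel_left, norm_smul, Real.norm_of_nonneg hε.le]
      have h2 : deviationThreshold (ε p.1) (ρ p.1) r₁ θ₀ (θ₀ + ε p.1 • x)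
          ≤ ρ p.1 * (ε p.1 + ε p.1 * ‖x‖) := by
        unfold deviationThreshold; gcongr
      have h3 : e p * ε p.1
          = k * (ρ p.1 * (ε p.1 + ε p.1 * ‖x‖)) + ‖fast k₀ (p.2 - b θ₀)‖ := by
        simp only [he_def]; field_simp
      rw [h3]; gcongr
    · simp only [hu]; field_simp
  have hγ := H.density_pos
  clear_value u e l
  rcases lt_or_gt_of_ne hx1 with hlt | hgt
  · set t₀ := √(1 - ‖B x‖ ^ 2) with ht₀
    have h1 : 0 < 1 - ‖B x‖ ^ 2 := by nlinarith
    have ht₀pos : 0 < t₀ := Real.sqrt_pos.2 h1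
    have ht₀sq : t₀ ^ 2 = 1 - ‖B x‖ ^ 2 := Real.sq_sqrt h1.le
    have ht₀lt : t₀ < 1 := by nlinarith
    have hlim : limitShape B 0 R 1 x = t₀ ^ R := by
      rw [limitShape, if_pos (by simpa using hlt.le), sub_zero, one_pow, div_one, ht₀,
        Real.sqrt_eq_rpow, ← Real.rpow_mul h1.le]
      ring_nf
    have hcont : ContinuousAt (fun t : ℝ => t ^ R) t₀ :=
      Real.continuousAt_rpow_const _ _ (Or.inl ht₀pos.ne')
    rw [hlim, tendsto_order]
    constructor
    · intro a ha
      obtain ⟨t, hta, ht0, htt⟩ : ∃ t : ℝ, a < t ^ R ∧ 0 < t ∧ t < t₀ := by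
        have h2 : ∀ᶠ t in 𝓝[<] t₀, a < t ^ R := nhdsWithin_le_nhds (hcont.eventually_const_lt ha)
        have h3 : ∀ᶠ t in 𝓝[<] t₀, 0 < t := nhdsWithin_le_nhds (lt_mem_nhds ht₀pos)
        obtain ⟨t, h⟩ := (h2.and (h3.and self_mem_nhdsWithin)).exists
        exact ⟨t, h.1, h.2.1, h.2.2⟩
      have hlim2 : Tendsto (fun p => t ^ 2 + (u p + e p) ^ 2) l (𝓝 (t ^ 2 + (‖B x‖ + 0) ^ 2)) :=
        ((hut.add het).pow 2).const_add _
      have hball := hl ▸ H.tendsto_real_ball_div M x ht0 (htt.le.trans ht₀lt.le)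
      filter_upwards [hbasic, hball.eventually_const_lt hta,
        hlim2.eventually_lt_const (u := 1) (by nlinarith)] with p hp h2 h3
      obtain ⟨hε, hL, hτ, hpe, hpu⟩ := hp
      refine h2.trans_le ?_
      have := hγ (slowScale (v p.1) (slow k₀ (p.2 - b θ₀)))
      unfold scaledProxy
      gcongr
      · exact measure_ne_top _ _
      refine subset_proxyEvent hτ hε hpe ?_
      have h5 : (t * ε p.1) ^ 2 + (u p * ε p.1 + e p * ε p.1) ^ 2
          = (t ^ 2 + (u p + e p) ^ 2) * ε p.1 ^ 2 := by ring
      rw [hpu, h5]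
      exact mul_le_of_le_one_left (sq_nonneg _) h3.le
    · intro a ha
      obtain ⟨t, hta, htt, ht1⟩ : ∃ t : ℝ, t ^ R < a ∧ t₀ < t ∧ t < 1 := by
        have h2 : ∀ᶠ t in 𝓝[>] t₀, t ^ R < a := nhdsWithin_le_nhds (hcont.eventually_lt_const ha)
        have h3 : ∀ᶠ t in 𝓝[>] t₀, t < 1 := nhdsWithin_le_nhds (gt_mem_nhds ht₀lt)
        obtain ⟨t, h⟩ := (h2.and (h3.and self_mem_nhdsWithin)).exists
        exact ⟨t, h.1, h.2.2, h.2.1⟩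
      have hlim2 : Tendsto (fun p => t ^ 2 + (u p - e p) ^ 2) l (𝓝 (t ^ 2 + (‖B x‖ - 0) ^ 2)) :=
        ((hut.sub het).pow 2).const_add _
      have ht0 : 0 < t := ht₀pos.trans htt
      have hball := hl ▸ H.tendsto_real_ball_div M x ht0 ht1.le
      filter_upwards [hbasic, hball.eventually_lt_const hta,
        hlim2.eventually_const_lt (u := 1) (by nlinarith),
        -- The outer inclusion needs the error below the fast distance, whence the assumption `0 <
        -- ‖B x‖`.
        (hut.sub het).eventually_const_lt (u := 0) (by simpa using hx0)] with p hp h2 h3 h4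
      obtain ⟨hε, hL, hτ, hpe, hpu⟩ := hp
      refine lt_of_le_of_lt ?_ h2
      have := hγ (slowScale (v p.1) (slow k₀ (p.2 - b θ₀)))
      unfold scaledProxy
      gcongr
      · exact measure_ne_top _ _
      refine proxyEvent_subset_of_lt hτ hpe ?_ (by positivity) ?_
      · rw [hpu]; gcongr; linarith
      · have h5 : (t * ε p.1) ^ 2 + (u p * ε p.1 - e p * ε p.1) ^ 2
            = (t ^ 2 + (u p - e p) ^ 2) * ε p.1 ^ 2 := by ring
        rw [hpu, h5]
        exact lt_mul_of_one_lt_left (pow_pos hε 2) h3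
  · have hlim : limitShape B 0 R 1 x = 0 := by
      rw [limitShape, if_neg (by simpa using hgt)]
    rw [hlim]
    refine tendsto_const_nhds.congr' ?_
    filter_upwards [hbasic, (hut.sub het).eventually_const_lt (u := 1) (by simpa using hgt)]
      with p hp h4
    obtain ⟨hε, hL, hτ, hpe, hpu⟩ := hp
    unfold scaledProxy
    rw [proxyEvent_eq_empty hτ hε hpe (by
      rw [hpu, ← sub_mul]; exact lt_mul_of_one_lt_left hε h4), measureReal_empty, zero_div]

end SmallBallAsymptotics

/-! ### L¹ limit of the proxy by dominated convergence -/

namespace SmallBallAsymptotics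

variable {Ω : ℕ → Type*} [∀ n, MeasurableSpace (Ω n)] {d k k₀ : ℕ}
  {P : (n : ℕ) → Kernel (EuclideanSpace ℝ (Fin d)) (Ω n)}
  {η : (n : ℕ) → Ω n → EuclideanSpace ℝ (Fin k)} {ε : ℕ → ℝ} {v : ℕ → Fin k → ℝ}
  {b : EuclideanSpace ℝ (Fin d) → EuclideanSpace ℝ (Fin k)} {θ₀ : EuclideanSpace ℝ (Fin d)}
  {δ R : ℝ} {γ : EuclideanSpace ℝ (SlowIdx k k₀) → ℝ} {L : ℕ → ℝ}
  {B : EuclideanSpace ℝ (Fin d) →L[ℝ] EuclideanSpace ℝ (FastIdx k k₀)} {ρ : ℕ → ℝ} {r₁ : ℝ}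

theorem measurable_deviationThreshold {ε ρ : ℝ} :
    Measurable (deviationThreshold ε ρ r₁ θ₀) := by
  unfold deviationThreshold
  have : Measurable fun θ : EuclideanSpace ℝ (Fin d) => ‖θ - θ₀‖ := by fun_prop
  exact ((this.min measurable_const).const_add _).const_mul _

theorem eventually_two_mul_lt (H : SmallBallAsymptotics P η ε v b θ₀ δ R γ L) {c₀ A : ℝ}
    (hc₀ : 0 < c₀) (hr₁ : 0 < r₁) (hA : 2 < c₀ * A) :
    ∀ᶠ n in atTop, ∀ θ, A * ε n ≤ ‖θ - θ₀‖ → 2 * ε n < c₀ * min ‖θ - θ₀‖ r₁ := by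
  have hc : 0 < c₀ * r₁ / 2 := by positivity
  filter_upwards [H.eps_tendsto.eventually_lt_const hc, eventually_ge_atTop 1] with n hn hn1 θ hθ
  have hε := H.eps_pos n hn1
  rw [mul_min_of_nonneg _ _ hc₀.le, lt_min_iff]
  constructor
  · calc 2 * ε n < c₀ * A * ε n := by gcongr
      _ = c₀ * (A * ε n) := by ring
      _ ≤ _ := by gcongr
  · linarith

variable [∀ n, IsMarkovKernel (P n)]

theorem measurable_scaledProxy (hη : ∀ n, Measurable (η n)) (hb : Measurable b)
    (p : ℕ × EuclideanSpace ℝ (Fin k)) :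
    Measurable (scaledProxy P η ε v b θ₀ γ L ρ r₁ p) := by
  unfold scaledProxy
  exact (measurable_kernel_real (P := P p.1) (measurableSet_proxyEvent (S := fun _ => p.2) (hη p.1)
    measurable_deviationThreshold measurable_const hb (b θ₀))).div_const _

/-- Scaled proxies are bounded on balls of radius of order `ε n`. -/
theorem exists_eventually_scaledProxy_le (H : SmallBallAsymptotics P η ε v b θ₀ δ R γ L)
    (M : ℝ) {A : ℝ} (hA : 0 < A) :
    ∃ C : ℝ, 0 < C ∧ ∀ᶠ p in typicalFilter k₀ ε v (b θ₀) M, ∀ x, ‖x‖ ≤ A →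
      scaledProxy P η ε v b θ₀ γ L ρ r₁ p (θ₀ + ε p.1 • x) ≤ C := by
  obtain ⟨g, hg, hgγ⟩ := H.exists_le_density M
  obtain ⟨C, hC, hCL⟩ := H.exists_eventually_real_le (M + 1)
  refine ⟨C / g, by positivity, ?_⟩
  have hfst : Tendsto Prod.fst (typicalFilter k₀ ε v (b θ₀) M) atTop := tendsto_fst_typicalFilter
  filter_upwards [eventually_norm_slowScale_le_typicalFilter, hfst.eventually hCL,
    hfst.eventually (H.eventually_norm_slowScale_sub_le hA one_pos),
    hfst.eventually (H.eventually_add_smul_mem_ball hA H.radius_pos),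
    hfst.eventually H.eventually_pos, hfst.eventually (eventually_ge_atTop 1)]
    with ⟨n, S⟩ h1 h2 h3 h4 hL hn x hx
  simp only at h1 h2 h3 h4 hL hn ⊢
  have hadd : slow k₀ S - slow k₀ (b (θ₀ + ε n • x))
      = slow k₀ (S - b θ₀) + slow k₀ (b θ₀ - b (θ₀ + ε n • x)) := by
    simp only [slow_sub]; abel
  have h5 := h2 _ (h4 x hx) (slow k₀ S) (by
    rw [hadd, slowScale_add]
    exact (norm_add_le _ _).trans (add_le_add h1 (h3 x hx)))
  have h6 := (measureReal_mono (μ := P n (θ₀ + ε n • x)) (proxyEvent_subset (η := η n) (k₀ := k₀)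
    (τ := deviationThreshold (ε n) (ρ n) r₁ θ₀ (θ₀ + ε n • x)) (S := S)
    (t := b (θ₀ + ε n • x)) (t₀ := b θ₀) (H.eps_pos n hn))).trans h5
  have h7 := hgγ _ h1
  unfold scaledProxy
  calc _ ≤ C * L n / (L n * g) := by gcongr
    _ = C / g := by field_simp

/-- With `m = min ‖θ - θ₀‖ r₁`, the total error is at most `ε / 2 + c₀ m / 4`. It leaves a fast
distance of at least `3 c₀ m / 4 - ε / 2`, which exceeds `ε`. The threshold has the same form `min
‖θ - θ₀‖ r₁` as the separation bound for this purpose. -/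
theorem proxyEvent_eq_empty_of_le {Ω : Type*} {η : Ω → EuclideanSpace ℝ (Fin k)} {ε ρ c₀ r₁ : ℝ}
    {S : EuclideanSpace ℝ (Fin k)} {θ : EuclideanSpace ℝ (Fin d)}
    (hε : 0 < ε) (hρ : 0 ≤ ρ) (hr₁ : 0 ≤ r₁) (hρ1 : k * ρ ≤ 1 / 4) (hρ2 : k * ρ ≤ c₀ / 4)
    (hS : ‖fast k₀ (S - b θ₀)‖ ≤ ε / 4)
    (h : c₀ * min ‖θ - θ₀‖ r₁ ≤ ‖fast k₀ (b θ) - fast k₀ (b θ₀)‖)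
    (hA : 2 * ε < c₀ * min ‖θ - θ₀‖ r₁) :
    proxyEvent η k₀ ε (deviationThreshold ε ρ r₁ θ₀ θ) S (b θ) (b θ₀) = ∅ := by
  have hmin : 0 ≤ min ‖θ - θ₀‖ r₁ := le_min (norm_nonneg _) hr₁
  refine proxyEvent_eq_empty (by unfold deviationThreshold; positivity) hε le_rfl ?_
  have h1 : k * deviationThreshold ε ρ r₁ θ₀ θ ≤ 1 / 4 * ε + c₀ / 4 * min ‖θ - θ₀‖ r₁ := by
    unfold deviationThreshold
    calc k * (ρ * (ε + min ‖θ - θ₀‖ r₁)) = k * ρ * ε + k * ρ * min ‖θ - θ₀‖ r₁ := by ring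
      _ ≤ _ := by gcongr
  rw [← fast_sub] at h
  linarith

/-- After rescaling, the integrand is bounded on `‖x‖ ≤ A` by the slow-ball estimate and vanishes
outside, and it tends to `0` off the null sets `x = 0` and `‖B x‖ = 1`. -/
theorem eventually_lintegral_scaledProxy_sub_le
    (H : SmallBallAsymptotics P η ε v b θ₀ δ R γ L) [Nontrivial (EuclideanSpace ℝ (Fin d))]
    (hη : ∀ n, Measurable (η n))
    {Θ : Set (EuclideanSpace ℝ (Fin d))} {π : EuclideanSpace ℝ (Fin d) → ℝ} (hπm : Measurable π)
    (hπ0 : ∀ θ, 0 ≤ π θ) (hπs : ∀ θ, θ ∉ Θ → π θ = 0) (hπc : ContinuousAt π θ₀) (hπp : 0 < π θ₀)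
    (hB : HasFDerivAt (fun θ => fast k₀ (b θ)) B θ₀) (hρ0 : ∀ n, 1 ≤ n → 0 ≤ ρ n)
    (hρ : Tendsto ρ atTop (𝓝 0)) (hr₁ : 0 < r₁) {c : ℝ} (hc : 0 < c) (hBc : ∀ x, c * ‖x‖ ≤ ‖B x‖)
    {c₀ : ℝ} (hc₀ : 0 < c₀)
    (hsep : ∀ θ ∈ Θ, c₀ * min ‖θ - θ₀‖ r₁ ≤ ‖fast k₀ (b θ) - fast k₀ (b θ₀)‖)
    (M : ℝ) {e : ℝ} (he : 0 < e) :
    ∀ᶠ p in typicalFilter k₀ ε v (b θ₀) M,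
      ∫⁻ θ, ENNReal.ofReal |π θ / π θ₀ * scaledProxy P η ε v b θ₀ γ L ρ r₁ p θ
        - limitShape B θ₀ R (ε p.1) θ| ≤ ENNReal.ofReal (e * ε p.1 ^ d) := by
  set l := typicalFilter k₀ ε v (b θ₀) M
  have hfst : Tendsto Prod.fst l atTop := tendsto_fst_typicalFilter
  obtain ⟨C, hC⟩ := H.lipschitz
  -- Beyond `A` the limiting shape vanishes thanks to `1 / c`, and the proxy event is empty thanks
  -- to `3 / c₀`.
  set A := 1 / c + 3 / c₀ with hAdef
  have hA : 0 < A := by positivity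
  have hAc : 1 ≤ c * A := by
    have : c * A = 1 + c * (3 / c₀) := by rw [hAdef]; field_simp
    rw [this]; linarith [show 0 ≤ c * (3 / c₀) by positivity]
  have hAc₀ : 2 < c₀ * A := by
    have : c₀ * A = 3 + c₀ / c := by rw [hAdef]; field_simp; ring
    rw [this]; linarith [show 0 ≤ c₀ / c by positivity]
  obtain ⟨C', hC', hbd⟩ := H.exists_eventually_scaledProxy_le (ρ := ρ) (r₁ := r₁) M hA
  have hπbd : ∀ᶠ θ in 𝓝 θ₀, π θ / π θ₀ ≤ 2 := by
    filter_upwards [hπc.eventually_lt_const (show π θ₀ < 2 * π θ₀ by linarith)] with θ hθ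
    rw [div_le_iff₀ hπp]; exact hθ.le
  obtain ⟨r, hr, hπr⟩ := Metric.eventually_nhds_iff_ball.1 hπbd
  have hlim : Tendsto (fun p : ℕ × EuclideanSpace ℝ (Fin k) => ∫⁻ x, ENNReal.ofReal
      |π (θ₀ + ε p.1 • x) / π θ₀ * scaledProxy P η ε v b θ₀ γ L ρ r₁ p (θ₀ + ε p.1 • x)
        - limitShape B 0 R 1 x|) l (𝓝 (∫⁻ _x : EuclideanSpace ℝ (Fin d), 0)) := by
    refine tendsto_lintegral_filter_of_dominated_convergence
      ((Metric.closedBall (0 : EuclideanSpace ℝ (Fin d)) A).indicator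
        fun _ => ENNReal.ofReal (2 * C' + 1)) ?_ ?_ ?_ ?_
    · refine Eventually.of_forall fun p => ?_
      have h1 : Measurable fun x : EuclideanSpace ℝ (Fin d) => θ₀ + ε p.1 • x := by fun_prop
      have h2 := (((hπm.comp h1).div_const (π θ₀)).mul
        ((measurable_scaledProxy (P := P) (ε := ε) (v := v) (θ₀ := θ₀) (γ := γ) (L := L) (ρ := ρ)
          (r₁ := r₁) hη hC.continuous.measurable p).comp h1)).sub
            (measurable_limitShape B 0 (R := R) (ε := 1))
      exact (measurable_norm.comp h2).ennreal_ofReal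
    · have hk1 : ∀ᶠ n in atTop, (k : ℝ) * ρ n < min (1 / 4) (c₀ / 4) := by
        have := hρ.const_mul (k : ℝ)
        rw [mul_zero] at this
        exact this.eventually_lt_const (by positivity)
      filter_upwards [hbd, hfst.eventually (H.eventually_add_smul_mem_ball hA hr),
        hfst.eventually (H.eventually_two_mul_lt hc₀ hr₁ hAc₀), hfst.eventually hk1,
        hfst.eventually (eventually_ge_atTop 1), hfst.eventually H.eventually_pos,
        tendsto_fast_typicalFilter.eventually_lt_const (show (0 : ℝ) < 1 / 4 by norm_num)]
        with p h1 h2 h3 h4 hn hL h5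
      have hε := H.eps_pos _ hn
      refine ae_of_all _ fun x => ?_
      by_cases hx : ‖x‖ ≤ A
      · rw [Set.indicator_of_mem (by simpa using hx)]
        apply ENNReal.ofReal_le_ofReal
        have h6 := limitShape_nonneg B 0 (R := R) one_pos x
        have h7 := limitShape_le_one B 0 H.exponent_nonneg one_pos x
        have h8 := h1 x hx
        have h9 := hπr _ (h2 x hx)
        have h10 := H.scaledProxy_nonneg (ρ := ρ) (r₁ := r₁) hL (θ₀ + ε p.1 • x)
        have h11 : π (θ₀ + ε p.1 • x) / π θ₀ *
            scaledProxy P η ε v b θ₀ γ L ρ r₁ p (θ₀ + ε p.1 • x) ≤ 2 * C' := by gcongr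
        have h12 : 0 ≤ π (θ₀ + ε p.1 • x) / π θ₀ *
            scaledProxy P η ε v b θ₀ γ L ρ r₁ p (θ₀ + ε p.1 • x) :=
          mul_nonneg (div_nonneg (hπ0 _) hπp.le) h10
        rw [abs_le]
        constructor <;> linarith
      · rw [Set.indicator_of_notMem (by simpa using hx)]
        rw [not_le] at hx
        have h6 : limitShape B 0 R 1 x = 0 := by
          refine if_neg (not_le.2 ?_)
          rw [sub_zero]
          calc 1 ≤ c * A := hAc
            _ < c * ‖x‖ := by gcongr
            _ ≤ ‖B x‖ := hBc x
        have h7 : π (θ₀ + ε p.1 • x) / π θ₀ *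
            scaledProxy P η ε v b θ₀ γ L ρ r₁ p (θ₀ + ε p.1 • x) = 0 := by
          by_cases hΘ : θ₀ + ε p.1 • x ∈ Θ
          · have h8 := h3 (θ₀ + ε p.1 • x) (by
              rw [add_sub_cancel_left, norm_smul, Real.norm_of_nonneg hε.le, mul_comm]
              gcongr)
            unfold scaledProxy
            rw [proxyEvent_eq_empty_of_le hε (hρ0 _ hn) hr₁.le (h4.le.trans (min_le_left _ _))
              (h4.le.trans (min_le_right _ _)) _ (hsep _ hΘ) h8]
            · simp
            · rw [div_lt_iff₀ hε] at h5
              linarith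
          · rw [hπs _ hΘ, zero_div, zero_mul]
        rw [h6, h7, sub_zero, abs_zero, ENNReal.ofReal_zero]
    · rw [lintegral_indicator measurableSet_closedBall, setLIntegral_const]
      exact ENNReal.mul_ne_top ENNReal.ofReal_ne_top (isCompact_closedBall _ _).measure_lt_top.ne
    · have h0 : ∀ᵐ x : EuclideanSpace ℝ (Fin d), x ≠ 0 := by
        simp [ae_iff]
      have h1 : ∀ᵐ x : EuclideanSpace ℝ (Fin d), ‖B x‖ ≠ 1 := by
        rw [ae_iff]; simpa using volume_norm_map_eq_one B
      filter_upwards [h0, h1] with x hx0 hx1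
      have hBx : 0 < ‖B x‖ := (mul_pos hc (norm_pos_iff.2 hx0)).trans_le (hBc x)
      have h2 := H.tendsto_scaledProxy hB hρ0 hρ hr₁.le M hBx hx1
      have h3 : Tendsto (fun p : ℕ × EuclideanSpace ℝ (Fin k) => π (θ₀ + ε p.1 • x) / π θ₀) l
          (𝓝 (π θ₀ / π θ₀)) := by
        refine (hπc.tendsto.comp ?_).div_const _
        have : Tendsto (fun p : ℕ × EuclideanSpace ℝ (Fin k) => θ₀ + ε p.1 • x) l
            (𝓝 (θ₀ + (0 : ℝ) • x)) :=
          ((H.eps_tendsto.comp hfst).smul_const x).const_add θ₀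
        simpa using this
      rw [div_self hπp.ne'] at h3
      have h4 := ((h3.mul h2).sub_const (limitShape B 0 R 1 x)).abs
      rw [one_mul, sub_self, abs_zero] at h4
      have := (ENNReal.continuous_ofReal.tendsto 0).comp h4
      rwa [ENNReal.ofReal_zero] at this
  rw [lintegral_zero] at hlim
  filter_upwards [hlim.eventually_le_const (ENNReal.ofReal_pos.2 he),
    hfst.eventually (eventually_ge_atTop 1)] with p hp hn
  have hε := H.eps_pos _ hn
  rw [lintegral_comp_add_smul _ θ₀ hε, mul_comm e, ENNReal.ofReal_mul (by positivity)]
  gcongr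
  simpa only [limitShape_add_smul B θ₀ hε] using hp

end SmallBallAsymptotics

/-! ### Deviations of the fast statistics -/

/-- The prior mean of the probability that the slow statistics are within `ε` of those of `S`
while a fast one deviates by more than `τ θ`. -/
def deviationMass {Ω : Type*} [MeasurableSpace Ω] {d k : ℕ}
    (P : Kernel (EuclideanSpace ℝ (Fin d)) Ω) (η : Ω → EuclideanSpace ℝ (Fin k)) (k₀ : ℕ) (ε : ℝ)
    (τ : EuclideanSpace ℝ (Fin d) → ℝ) (b : EuclideanSpace ℝ (Fin d) → EuclideanSpace ℝ (Fin k))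
    (π : EuclideanSpace ℝ (Fin d) → ℝ) (S : EuclideanSpace ℝ (Fin k)) : ℝ≥0∞ :=
  ∫⁻ θ, ENNReal.ofReal (π θ) * P θ (deviationEvent η k₀ ε (τ θ) S (b θ))

section Tonelli

variable {Ω : Type*} [MeasurableSpace Ω] {d k : ℕ}
  {P : Kernel (EuclideanSpace ℝ (Fin d)) Ω} [IsMarkovKernel P]
  {η : Ω → EuclideanSpace ℝ (Fin k)} {k₀ : ℕ} {ε : ℝ}
  {τ : EuclideanSpace ℝ (Fin d) → ℝ} {b : EuclideanSpace ℝ (Fin d) → EuclideanSpace ℝ (Fin k)}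
  {π : EuclideanSpace ℝ (Fin d) → ℝ}

theorem measurable_mul_deviationEvent (hη : Measurable η) (hτ : Measurable τ) (hb : Measurable b)
    (hπ : Measurable π) : Measurable fun p : Ω × EuclideanSpace ℝ (Fin d) =>
      ENNReal.ofReal (π p.2) * P p.2 (deviationEvent η k₀ ε (τ p.2) (η p.1) (b p.2)) := by
  refine (hπ.comp measurable_snd).ennreal_ofReal.mul ?_
  have h := measurableSet_deviationEvent (α := Ω × EuclideanSpace ℝ (Fin d)) (k₀ := k₀) (ε := ε) hη
    (hτ.comp measurable_snd) (hη.comp measurable_fst) (hb.comp measurable_snd)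
  exact Kernel.measurable_kernel_prodMk_left (κ := P.comap Prod.snd measurable_snd) h

theorem measurable_deviationMass (hη : Measurable η) (hτ : Measurable τ) (hb : Measurable b)
    (hπ : Measurable π) : Measurable fun y => deviationMass P η k₀ ε τ b π (η y) :=
  (measurable_mul_deviationEvent hη hτ hb hπ).lintegral_prod_right'

/-- For fixed `z` the fast condition no longer involves `y`, while the slow one says that `y` falls
in a ball around `η z`, of `μ`-measure at most `q`. The small-ball factor thus comes from the
observation, and the fast tail stays unconditional. -/
theorem lintegral_deviationMass_le (hη : Measurable η) (hτ : Measurable τ) (hb : Measurable b)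
    (hπ : Measurable π) (μ : Measure Ω) [IsFiniteMeasure μ] {q : ℝ≥0∞}
    (hq : ∀ z, μ {y | ‖slow k₀ (η y - η z)‖ ≤ ε} ≤ q) :
    ∫⁻ y, deviationMass P η k₀ ε τ b π (η y) ∂μ ≤ q * ∫⁻ θ, ENNReal.ofReal (π θ) *
      P θ {z | ∃ j : FastIdx k k₀, τ θ < |η z j.1 - b θ j.1|} := by
  unfold deviationMass
  rw [lintegral_lintegral_swap (measurable_mul_deviationEvent hη hτ hb hπ).aemeasurable]
  have hfast : ∀ θ, MeasurableSet {z | ∃ j : FastIdx k k₀, τ θ < |η z j.1 - b θ j.1|} := by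
    intro θ
    -- On the diagonal the slow condition reads `0 ≤ 0`, so only the fast one remains.
    have h := measurableSet_deviationEvent (α := Ω) (k₀ := k₀) (ε := 0) hη
      (measurable_const (a := τ θ)) hη (measurable_const (a := b θ))
    have hdiag : Measurable fun z : Ω => (z, z) := by fun_prop
    convert hdiag h using 1
    ext z
    have h0 : slow k₀ (0 : EuclideanSpace ℝ (Fin k)) = 0 := rfl
    simp [deviationEvent, h0]
  have hjoint : ∀ θ, MeasurableSet
      {p : Ω × Ω | p.2 ∈ deviationEvent η k₀ ε (τ θ) (η p.1) (b θ)} := fun θ =>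
    measurableSet_deviationEvent (α := Ω) hη measurable_const hη measurable_const
  calc ∫⁻ θ, ∫⁻ y, ENNReal.ofReal (π θ) * P θ (deviationEvent η k₀ ε (τ θ) (η y) (b θ)) ∂μ
      ≤ ∫⁻ θ, q * (ENNReal.ofReal (π θ) *
          P θ {z | ∃ j : FastIdx k k₀, τ θ < |η z j.1 - b θ j.1|}) := by
        refine lintegral_mono fun θ => ?_
        simp only
        rw [lintegral_const_mul' _ _ ENNReal.ofReal_ne_top, mul_left_comm]
        gcongr
        calc ∫⁻ y, P θ (deviationEvent η k₀ ε (τ θ) (η y) (b θ)) ∂μ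
            = (μ.prod (P θ)) {p : Ω × Ω | p.2 ∈ deviationEvent η k₀ ε (τ θ) (η p.1) (b θ)} :=
              (Measure.prod_apply (hjoint θ)).symm
          _ = ∫⁻ z, μ {y | z ∈ deviationEvent η k₀ ε (τ θ) (η y) (b θ)} ∂(P θ) :=
              Measure.prod_apply_symm (hjoint θ)
          _ ≤ ∫⁻ z, {z | ∃ j : FastIdx k k₀, τ θ < |η z j.1 - b θ j.1|}.indicator
                (fun _ => q) z ∂(P θ) := by
              refine lintegral_mono fun z => ?_
              by_cases hz : z ∈ {z | ∃ j : FastIdx k k₀, τ θ < |η z j.1 - b θ j.1|}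
              · rw [Set.indicator_of_mem hz]
                exact (measure_mono fun y hy => hy.1).trans (hq z)
              · rw [Set.indicator_of_notMem hz]
                refine le_of_eq (measure_mono_null (fun y hy => hz hy.2) measure_empty)
          _ = _ := lintegral_indicator_const (hfast θ) q
    _ = _ := lintegral_const_mul _ (by
        refine hπ.ennreal_ofReal.mul ?_
        have h : MeasurableSet {p : EuclideanSpace ℝ (Fin d) × Ω |
            ∃ j : FastIdx k k₀, τ p.1 < |η p.2 j.1 - b p.1 j.1|} := by
          simp only [Set.ofPred_exists]
          refine MeasurableSet.iUnion fun j => ?_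
          simpa [Set.compl_def] using (measurableSet_fast_deviation hη hτ hb j.1).compl
        exact Kernel.measurable_kernel_prodMk_left h)

end Tonelli

/-- Integrals against a truncated polynomially decaying kernel, concentrated at scale `ε`. -/
theorem exists_lintegral_mul_rpow_le {d : ℕ} {θ₀ : EuclideanSpace ℝ (Fin d)}
    {f : EuclideanSpace ℝ (Fin d) → ℝ} (hf0 : ∀ θ, 0 ≤ f θ) (hf : Integrable f)
    {C r₁ : ℝ} (hC : 0 < C) (hr₁ : 0 < r₁) (hfC : ∀ θ ∈ Metric.ball θ₀ r₁, f θ ≤ C)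
    {κ : ℝ} (hκ : (d : ℝ) < κ) :
    ∃ K : ℝ, 0 < K ∧ ∀ ε a : ℝ, 0 < ε → ε ≤ 1 → 0 < a →
      ∫⁻ θ, ENNReal.ofReal (f θ * (a * (ε + min ‖θ - θ₀‖ r₁)) ^ (-κ))
        ≤ ENNReal.ofReal (K * ((a * ε) ^ (-κ) * ε ^ d)) := by
  have hκ0 : 0 < κ := (Nat.cast_nonneg d).trans_lt hκ
  have hint : Integrable fun x : EuclideanSpace ℝ (Fin d) => (1 + ‖x‖) ^ (-κ) :=
    integrable_one_add_norm (by rwa [finrank_euclideanSpace_fin])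
  set J := ∫ x : EuclideanSpace ℝ (Fin d), (1 + ‖x‖) ^ (-κ)
  have hJ : 0 ≤ J := integral_nonneg fun x => by positivity
  set F := ∫ θ, f θ
  have hF : 0 ≤ F := integral_nonneg hf0
  refine ⟨C * J + F * r₁ ^ (-κ) + 1, by positivity, fun ε a hε hε1 ha => ?_⟩
  -- Near `θ₀` the bound on `f` applies and the kernel is integrable because `κ > d`; far away the
  -- kernel is bounded and `f` is integrable.
  have hpt : ∀ θ, f θ * (a * (ε + min ‖θ - θ₀‖ r₁)) ^ (-κ)
      ≤ C * (a * (ε + ‖θ - θ₀‖)) ^ (-κ) + f θ * (a * r₁) ^ (-κ) := by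
    intro θ
    rcases lt_or_ge ‖θ - θ₀‖ r₁ with h | h
    · rw [min_eq_left h.le]
      have h1 := hfC θ (by rwa [mem_ball_iff_norm])
      have h2 : 0 ≤ f θ * (a * r₁) ^ (-κ) := mul_nonneg (hf0 θ) (by positivity)
      have h3 : f θ * (a * (ε + ‖θ - θ₀‖)) ^ (-κ) ≤ C * (a * (ε + ‖θ - θ₀‖)) ^ (-κ) := by gcongr
      linarith
    · rw [min_eq_right h]
      have h2 : 0 ≤ C * (a * (ε + ‖θ - θ₀‖)) ^ (-κ) := by positivity
      have h3 : (a * (ε + r₁)) ^ (-κ) ≤ (a * r₁) ^ (-κ) := by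
        refine Real.rpow_le_rpow_of_nonpos (by positivity) ?_ (by linarith)
        gcongr; linarith
      have h4 := mul_le_mul_of_nonneg_left h3 (hf0 θ)
      linarith
  have hnear : ∫⁻ θ, ENNReal.ofReal (C * (a * (ε + ‖θ - θ₀‖)) ^ (-κ))
      = ENNReal.ofReal (ε ^ d * (C * (a * ε) ^ (-κ) * J)) := by
    rw [lintegral_comp_add_smul _ θ₀ hε]
    have h1 : ∀ x : EuclideanSpace ℝ (Fin d), C * (a * (ε + ‖θ₀ + ε • x - θ₀‖)) ^ (-κ)
        = C * (a * ε) ^ (-κ) * (1 + ‖x‖) ^ (-κ) := by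
      intro x
      rw [add_sub_cancel_left, norm_smul, Real.norm_of_nonneg hε.le, mul_assoc C,
        ← Real.mul_rpow (by positivity) (by positivity)]
      ring_nf
    simp only [h1]
    rw [← ofReal_integral_eq_lintegral_ofReal (hint.const_mul _)
      (ae_of_all _ fun x => by simp only [Pi.zero_apply]; positivity), integral_const_mul,
      ← ENNReal.ofReal_mul (by positivity)]
  have hfar : ∫⁻ θ, ENNReal.ofReal (f θ * (a * r₁) ^ (-κ))
      = ENNReal.ofReal (F * (a * r₁) ^ (-κ)) := by
    rw [← ofReal_integral_eq_lintegral_ofReal (hf.mul_const _)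
      (ae_of_all _ fun θ => mul_nonneg (hf0 θ) (by positivity)), integral_mul_const]
  -- The far part is dominated by the near scale because `ε ^ (d - κ) ≥ 1` for `ε ≤ 1`.
  have hscale : (a * r₁) ^ (-κ) ≤ r₁ ^ (-κ) * ((a * ε) ^ (-κ) * ε ^ d) := by
    rw [Real.mul_rpow ha.le hr₁.le, Real.mul_rpow ha.le hε.le]
    have h1 : 1 ≤ ε ^ (-κ) * ε ^ d := by
      rw [← Real.rpow_natCast ε d, ← Real.rpow_add hε]
      exact Real.one_le_rpow_of_pos_of_le_one_of_nonpos hε hε1 (by linarith)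
    calc a ^ (-κ) * r₁ ^ (-κ) = r₁ ^ (-κ) * a ^ (-κ) * 1 := by ring
      _ ≤ r₁ ^ (-κ) * a ^ (-κ) * (ε ^ (-κ) * ε ^ d) := by gcongr
      _ = _ := by ring
  calc ∫⁻ θ, ENNReal.ofReal (f θ * (a * (ε + min ‖θ - θ₀‖ r₁)) ^ (-κ))
      ≤ ∫⁻ θ, (ENNReal.ofReal (C * (a * (ε + ‖θ - θ₀‖)) ^ (-κ))
          + ENNReal.ofReal (f θ * (a * r₁) ^ (-κ))) :=
        lintegral_mono fun θ => (ENNReal.ofReal_le_ofReal (hpt θ)).trans ENNReal.ofReal_add_le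
    _ = ENNReal.ofReal (ε ^ d * (C * (a * ε) ^ (-κ) * J))
          + ENNReal.ofReal (F * (a * r₁) ^ (-κ)) := by
        rw [lintegral_add_right' _ (hf.mul_const _).1.aemeasurable.ennreal_ofReal, hnear, hfar]
    _ = ENNReal.ofReal (ε ^ d * (C * (a * ε) ^ (-κ) * J) + F * (a * r₁) ^ (-κ)) :=
        (ENNReal.ofReal_add (by positivity) (by positivity)).symm
    _ ≤ _ := by
        apply ENNReal.ofReal_le_ofReal
        have h1 := mul_le_mul_of_nonneg_left hscale hF
        have h2 : 0 ≤ (a * ε) ^ (-κ) * ε ^ d := by positivity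
        linarith

namespace SmallBallAsymptotics

variable {Ω : ℕ → Type*} [∀ n, MeasurableSpace (Ω n)] {d k k₀ : ℕ}
  {P : (n : ℕ) → Kernel (EuclideanSpace ℝ (Fin d)) (Ω n)} [∀ n, IsMarkovKernel (P n)]
  {η : (n : ℕ) → Ω n → EuclideanSpace ℝ (Fin k)} {ε : ℕ → ℝ} {v : ℕ → Fin k → ℝ}
  {b : EuclideanSpace ℝ (Fin d) → EuclideanSpace ℝ (Fin k)} {θ₀ : EuclideanSpace ℝ (Fin d)}
  {δ R : ℝ} {γ : EuclideanSpace ℝ (SlowIdx k k₀) → ℝ} {L : ℕ → ℝ}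

/-- Under the true parameter, slow statistics whose scaled version is bounded fall into any given
closed ball of radius `ε n` with probability of order at most `L n`. -/
theorem exists_eventually_restrict_le (H : SmallBallAsymptotics P η ε v b θ₀ δ R γ L)
    (M : ℝ) (hη : ∀ n, Measurable (η n)) :
    ∃ C : ℝ, 0 < C ∧ ∀ᶠ n in atTop, ∀ z,
      (P n θ₀).restrict {y | ‖slowScale (v n) (slow k₀ (η n y - b θ₀))‖ ≤ M}
        {y | ‖slow k₀ (η n y - η n z)‖ ≤ ε n} ≤ ENNReal.ofReal (C * L n) := by
  obtain ⟨C, hC, hCL⟩ := H.exists_eventually_real_le (M + 1)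
  refine ⟨C, hC, ?_⟩
  filter_upwards [hCL, H.eventually_norm_slowScale_le one_pos one_pos] with n h1 h2 z
  have hmeas : MeasurableSet {y | ‖slow k₀ (η n y - η n z)‖ ≤ ε n} :=
    measurableSet_le ((measurable_slow k₀).comp ((hη n).sub_const _)).norm measurable_const
  rw [Measure.restrict_apply hmeas]
  -- One typical `y` near `z` forces the scaled slow part of `z` to be at most `M + 1`, so the
  -- small-ball bound centred at `z` applies; without such a `y` the measure is zero.
  by_cases hne : ({y | ‖slow k₀ (η n y - η n z)‖ ≤ ε n} ∩
      {y | ‖slowScale (v n) (slow k₀ (η n y - b θ₀))‖ ≤ M}).Nonempty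
  · obtain ⟨y, hy1, hy2⟩ := hne
    have hadd : slow k₀ (η n z) - slow k₀ (b θ₀)
        = slow k₀ (η n y - b θ₀) + -slow k₀ (η n y - η n z) := by
      simp only [slow_sub]; abel
    have h3 := h1 θ₀ (Metric.mem_ball_self H.radius_pos) (slow k₀ (η n z)) (by
      rw [hadd, slowScale_add]
      refine (norm_add_le _ _).trans (add_le_add hy2 (h2 _ ?_))
      rw [norm_neg, one_mul]; exact hy1)
    rw [← ENNReal.ofReal_toReal (measure_ne_top (P n θ₀) _)]
    refine ENNReal.ofReal_le_ofReal (le_trans ?_ h3)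
    refine measureReal_mono (μ := P n θ₀) fun y hy => ?_
    have : ‖slow k₀ (η n y) - slow k₀ (η n z)‖ ≤ ε n := hy.1
    rwa [norm_sub_rev] at this
  · rw [Set.not_nonempty_iff_eq_empty.1 hne, measure_empty]
    exact bot_le

/-- The slow ball gives `L n`, and the tail at the threshold gives `(v ρ ε) ^ (-κ) * ε ^ d`, where
the first factor tends to `0`. -/
theorem eventually_setLIntegral_deviationMass_le
    (H : SmallBallAsymptotics P η ε v b θ₀ δ R γ L) (hk : k₀ < k) (hη : ∀ n, Measurable (η n))
    (hv : ∀ n, 1 ≤ n → Monotone (v n))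
    {Θ : Set (EuclideanSpace ℝ (Fin d))} {π : EuclideanSpace ℝ (Fin d) → ℝ} (hπm : Measurable π)
    (hπ0 : ∀ θ, 0 ≤ π θ) (hπs : ∀ θ, θ ∉ Θ → π θ = 0)
    {u₀ κ : ℝ} (hu₀ : 0 < u₀) (hκ : (d : ℝ) < κ) {c : EuclideanSpace ℝ (Fin d) → ℝ}
    (hcπ : IntegrableOn (fun θ => c θ * π θ) Θ) {C r₁ : ℝ} (hC : 0 < C) (hr₁ : 0 < r₁)
    (hcC : ∀ θ ∈ Metric.ball θ₀ r₁, c θ * π θ ≤ C)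
    (htail : ∀ n, 1 ≤ n → ∀ u : ℝ, u₀ < u → ∀ θ ∈ Θ, ∀ j : Fin k, k₀ ≤ (j : ℕ) →
      (P n θ).real {z | u < |normalised (v n) (b θ) (η n z) j|} ≤ c θ * u ^ (-κ))
    {ρ : ℕ → ℝ} (hρ : ∀ n, 1 ≤ n → 0 < ρ n)
    (hρv : Tendsto (fun n => v n ⟨k₀, hk⟩ * ρ n * ε n) atTop atTop)
    (M : ℝ) {e : ℝ} (he : 0 < e) :
    ∀ᶠ n in atTop,
      ∫⁻ y in {y | ‖slowScale (v n) (slow k₀ (η n y - b θ₀))‖ ≤ M},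
        deviationMass (P n) (η n) k₀ (ε n) (deviationThreshold (ε n) (ρ n) r₁ θ₀) b π (η n y)
          ∂(P n θ₀) ≤ ENNReal.ofReal (e * (L n * ε n ^ d)) := by
  obtain ⟨C₁, hC₁, hrestrict⟩ := H.exists_eventually_restrict_le M hη
  obtain ⟨Cb, hCb⟩ := H.lipschitz
  -- Nonnegativity of `c` is forced by the tail bound: one admissible pair `n = 1`, `u = u₀ + 1`
  -- suffices.
  have hc0 : ∀ θ ∈ Θ, 0 ≤ c θ := by
    intro θ hθ
    have h := measureReal_nonneg.trans (htail 1 le_rfl (u₀ + 1) (by linarith) θ hθ ⟨k₀, hk⟩ le_rfl)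
    exact nonneg_of_mul_nonneg_left h (by positivity)
  have hf0 : ∀ θ, 0 ≤ c θ * π θ := by
    intro θ
    by_cases hθ : θ ∈ Θ
    · exact mul_nonneg (hc0 θ hθ) (hπ0 θ)
    · rw [hπs θ hθ, mul_zero]
  have hf : Integrable fun θ => c θ * π θ := by
    refine (integrableOn_iff_integrable_of_support_subset fun θ hθ => ?_).1 hcπ
    by_contra h
    exact hθ (by simp [hπs θ h])
  obtain ⟨K, hK, hKle⟩ := exists_lintegral_mul_rpow_le hf0 hf hC hr₁ hcC hκ
  have hκ0 : 0 < κ := (Nat.cast_nonneg d).trans_lt hκ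
  have hk0 : (0 : ℝ) < k := by exact_mod_cast Nat.zero_lt_of_lt hk
  have hsmall : ∀ᶠ n in atTop, (v n ⟨k₀, hk⟩ * ρ n * ε n) ^ (-κ) < e / (C₁ * k * K) :=
    ((tendsto_rpow_neg_atTop hκ0).comp hρv).eventually_lt_const (by positivity)
  filter_upwards [hrestrict, hsmall, hρv.eventually_gt_atTop u₀, H.eventually_pos,
    H.eps_tendsto.eventually_le_const one_pos, eventually_ge_atTop 1] with n h1 h2 h3 hL hε1 hn
  have hε := H.eps_pos n hn
  have hvk := H.rate_pos n hn ⟨k₀, hk⟩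
  have hρn := hρ n hn
  refine (lintegral_deviationMass_le (hη n) measurable_deviationThreshold hCb.continuous.measurable
    hπm _ h1).trans ?_
  have hpt : ∀ θ, ENNReal.ofReal (π θ) * P n θ {z | ∃ j : FastIdx k k₀,
      deviationThreshold (ε n) (ρ n) r₁ θ₀ θ < |η n z j.1 - b θ j.1|}
      ≤ k * ENNReal.ofReal
        (c θ * π θ * (v n ⟨k₀, hk⟩ * ρ n * (ε n + min ‖θ - θ₀‖ r₁)) ^ (-κ)) := by
    intro θ
    by_cases hθ : θ ∈ Θ
    · set u := v n ⟨k₀, hk⟩ * ρ n * (ε n + min ‖θ - θ₀‖ r₁) with hu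
      have hmin : 0 ≤ min ‖θ - θ₀‖ r₁ := le_min (norm_nonneg _) hr₁.le
      have hu₀u : u₀ < u := by
        refine h3.trans_le ?_
        rw [hu]; gcongr; linarith
      have hj : ∀ j : FastIdx k k₀, P n θ {z | deviationThreshold (ε n) (ρ n) r₁ θ₀ θ
          < |η n z j.1 - b θ j.1|} ≤ ENNReal.ofReal (c θ * u ^ (-κ)) := by
        intro j
        rw [← ENNReal.ofReal_toReal (measure_ne_top (P n θ) _)]
        refine ENNReal.ofReal_le_ofReal (le_trans ?_ (htail n hn u hu₀u θ hθ j.1 j.2))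
        refine measureReal_mono (μ := P n θ) fun z hz => ?_
        have hz' : deviationThreshold (ε n) (ρ n) r₁ θ₀ θ < |η n z j.1 - b θ j.1| := hz
        -- With indices from `0`, `k₀` is the first fast component, hence the one with the smallest
        -- fast rate.
        have hvj : v n ⟨k₀, hk⟩ ≤ v n j.1 := hv n hn j.2
        have hvj0 := H.rate_pos n hn j.1
        change u < |v n j.1 * (η n z j.1 - b θ j.1)|
        rw [abs_mul, abs_of_pos hvj0]
        calc u = v n ⟨k₀, hk⟩ * deviationThreshold (ε n) (ρ n) r₁ θ₀ θ := by
              rw [hu, deviationThreshold]; ring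
          _ ≤ v n j.1 * deviationThreshold (ε n) (ρ n) r₁ θ₀ θ := by
              gcongr
              unfold deviationThreshold; positivity
          _ < _ := by gcongr
      have hunion : P n θ {z | ∃ j : FastIdx k k₀,
          deviationThreshold (ε n) (ρ n) r₁ θ₀ θ < |η n z j.1 - b θ j.1|}
          ≤ k * ENNReal.ofReal (c θ * u ^ (-κ)) := by
        rw [Set.ofPred_exists]
        refine (measure_iUnion_fintype_le _ _).trans ((Finset.sum_le_sum fun j _ => hj j).trans ?_)
        rw [Finset.sum_const, nsmul_eq_mul]
        gcongr
        exact (Fintype.card_subtype_le _).trans_eq (Fintype.card_fin k)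
      calc _ ≤ ENNReal.ofReal (π θ) * (k * ENNReal.ofReal (c θ * u ^ (-κ))) := by gcongr
        _ = k * ENNReal.ofReal (c θ * π θ * u ^ (-κ)) := by
          rw [mul_left_comm, ← ENNReal.ofReal_mul (hπ0 θ)]
          congr 2; ring
    · rw [hπs θ hθ, ENNReal.ofReal_zero, zero_mul]
      exact bot_le
  calc ENNReal.ofReal (C₁ * L n) * ∫⁻ θ, ENNReal.ofReal (π θ) * P n θ {z | ∃ j : FastIdx k k₀,
        deviationThreshold (ε n) (ρ n) r₁ θ₀ θ < |η n z j.1 - b θ j.1|}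
      ≤ ENNReal.ofReal (C₁ * L n) * ∫⁻ θ, k * ENNReal.ofReal
        (c θ * π θ * (v n ⟨k₀, hk⟩ * ρ n * (ε n + min ‖θ - θ₀‖ r₁)) ^ (-κ)) := by
        exact mul_le_mul' le_rfl (lintegral_mono hpt)
    _ ≤ ENNReal.ofReal (C₁ * L n) * (ENNReal.ofReal k * ENNReal.ofReal
        (K * ((v n ⟨k₀, hk⟩ * ρ n * ε n) ^ (-κ) * ε n ^ d))) := by
        rw [lintegral_const_mul' _ _ (ENNReal.natCast_ne_top k), ENNReal.ofReal_natCast]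
        gcongr
        exact hKle _ _ hε hε1 (by positivity)
    _ = ENNReal.ofReal (C₁ * L n *
        (k * (K * ((v n ⟨k₀, hk⟩ * ρ n * ε n) ^ (-κ) * ε n ^ d)))) := by
        rw [← ENNReal.ofReal_mul (by positivity), ← ENNReal.ofReal_mul (by positivity)]
    _ ≤ ENNReal.ofReal (C₁ * L n * (k * (K * (e / (C₁ * k * K) * ε n ^ d)))) := by
        apply ENNReal.ofReal_le_ofReal
        gcongr
    _ = ENNReal.ofReal (e * (L n * ε n ^ d)) := by
        congr 1; field_simp

end SmallBallAsymptotics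

/-! ### From L¹ closeness to total variation, and convergence in probability -/

section Posterior

variable {Ω : Type*} [MeasurableSpace Ω] {d k : ℕ}
  {P : Kernel (EuclideanSpace ℝ (Fin d)) Ω} [IsMarkovKernel P]
  {η : Ω → EuclideanSpace ℝ (Fin k)} {ε : ℝ} {π : EuclideanSpace ℝ (Fin d) → ℝ}

theorem measurable_abcLikelihood (hη : Measurable η) (y : Ω) :
    Measurable fun θ => abcLikelihood (P θ) η ε y := by
  have h : MeasurableSet {p : EuclideanSpace ℝ (Fin d) × Ω | ‖η y - η p.2‖ ≤ ε} :=
    measurableSet_le (by fun_prop) measurable_const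
  exact measurable_kernel_real h

/-- If the unnormalised posterior, divided by any constant, is close in `L¹` to the limiting
shape, then so is the posterior to the limiting density. -/
theorem abcEvidence_pos_and_tvDist_lt {F : Type*} [NormedAddCommGroup F] [NormedSpace ℝ F]
    {B : EuclideanSpace ℝ (Fin d) →L[ℝ] F} {θ₀ : EuclideanSpace ℝ (Fin d)} {R : ℝ}
    (hη : Measurable η) (hπm : Measurable π) (hπ0 : ∀ θ, 0 ≤ π θ)
    (hw : Integrable (limitShape B θ₀ R ε)) {y : Ω} {N D e : ℝ} (hN : 0 < N) (hD0 : 0 ≤ D)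
    (hD : ∫⁻ θ, ENNReal.ofReal |π θ * abcLikelihood (P θ) η ε y / N - limitShape B θ₀ R ε θ|
      ≤ ENNReal.ofReal D)
    (hDI : D < ∫ θ, limitShape B θ₀ R ε θ) (he : 2 * D / (∫ θ, limitShape B θ₀ R ε θ) < e) :
    0 < abcEvidence P η π ε y ∧
      tvDist (abcPosterior P η π ε y) (limitDensity B θ₀ R ε) < ENNReal.ofReal e := by
  have hm : Measurable fun θ => π θ * abcLikelihood (P θ) η ε y / N :=
    (hπm.mul (measurable_abcLikelihood hη y)).div_const N
  obtain ⟨h1, h2⟩ := lintegral_normalize_sub_le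
    (fun θ => div_nonneg (mul_nonneg (hπ0 θ) measureReal_nonneg) hN.le)
    hm.aestronglyMeasurable hw hD0 hD hDI
  rw [integral_div] at h1 h2
  have hev : 0 < abcEvidence P η π ε y := by
    have := mul_pos h1 hN
    rwa [div_mul_cancel₀ _ hN.ne'] at this
  refine ⟨hev, ?_⟩
  have heq : ∀ θ, π θ * abcLikelihood (P θ) η ε y / N /
      ((∫ θ, π θ * abcLikelihood (P θ) η ε y) / N) = abcPosterior P η π ε y θ := by
    intro θ
    rw [div_div_div_cancel_right₀ hN.ne']
    rfl
  have hle : ∫⁻ θ, ENNReal.ofReal |abcPosterior P η π ε y θ - limitDensity B θ₀ R ε θ|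
      ≤ ENNReal.ofReal (2 * D / ∫ θ, limitShape B θ₀ R ε θ) := by
    refine le_of_eq_of_le (lintegral_congr fun θ => ?_) h2
    rw [← heq]
    rfl
  have he0 : 0 ≤ 2 * D / (∫ θ, limitShape B θ₀ R ε θ) :=
    div_nonneg (by linarith) (hD0.trans hDI.le)
  calc tvDist (abcPosterior P η π ε y) (limitDensity B θ₀ R ε)
      ≤ 1 * ∫⁻ θ, ENNReal.ofReal |abcPosterior P η π ε y θ - limitDensity B θ₀ R ε θ| := by
        unfold tvDist
        gcongr
        exact ENNReal.inv_le_one.2 one_le_two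
    _ ≤ ENNReal.ofReal (2 * D / (∫ θ, limitShape B θ₀ R ε θ)) := by rwa [one_mul]
    _ < ENNReal.ofReal e := (ENNReal.ofReal_lt_ofReal_iff (he0.trans_lt he)).2 he

end Posterior

namespace SmallBallAsymptotics

variable {Ω : ℕ → Type*} [∀ n, MeasurableSpace (Ω n)] {d k k₀ : ℕ}
  {P : (n : ℕ) → Kernel (EuclideanSpace ℝ (Fin d)) (Ω n)} [∀ n, IsMarkovKernel (P n)]
  {η : (n : ℕ) → Ω n → EuclideanSpace ℝ (Fin k)} {ε : ℕ → ℝ} {v : ℕ → Fin k → ℝ}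
  {b : EuclideanSpace ℝ (Fin d) → EuclideanSpace ℝ (Fin k)} {θ₀ : EuclideanSpace ℝ (Fin d)}
  {δ R : ℝ} {γ : EuclideanSpace ℝ (SlowIdx k k₀) → ℝ} {L : ℕ → ℝ}
  {B : EuclideanSpace ℝ (Fin d) →L[ℝ] EuclideanSpace ℝ (FastIdx k k₀)} {ρ : ℕ → ℝ} {r₁ : ℝ}

/-- The unnormalised posterior is close in `L¹` to the limiting shape as soon as its proxy is and
the deviations of the fast statistics are negligible. -/
theorem lintegral_abcLikelihood_sub_le (H : SmallBallAsymptotics P η ε v b θ₀ δ R γ L)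
    (hη : ∀ n, Measurable (η n))
    {π : EuclideanSpace ℝ (Fin d) → ℝ} (hπm : Measurable π)
    (hπ0 : ∀ θ, 0 ≤ π θ) (hπp : 0 < π θ₀) {n : ℕ} (hn : 1 ≤ n) (hL : 0 < L n) {y : Ω n}
    {g D D' : ℝ} (hg : 0 < g) (hgγ : g ≤ γ (slowScale (v n) (slow k₀ (η n y - b θ₀))))
    (hD : 0 ≤ D) (hD' : 0 ≤ D')
    (hproxy : ∫⁻ θ, ENNReal.ofReal |π θ / π θ₀ * scaledProxy P η ε v b θ₀ γ L ρ r₁ (n, η n y) θ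
        - limitShape B θ₀ R (ε n) θ| ≤ ENNReal.ofReal D)
    (hdev : deviationMass (P n) (η n) k₀ (ε n) (deviationThreshold (ε n) (ρ n) r₁ θ₀) b π (η n y)
      ≤ ENNReal.ofReal (D' * (L n * g * π θ₀))) :
    ∫⁻ θ, ENNReal.ofReal |π θ * abcLikelihood (P n θ) (η n) (ε n) y
        / (L n * γ (slowScale (v n) (slow k₀ (η n y - b θ₀))) * π θ₀) - limitShape B θ₀ R (ε n) θ|
      ≤ ENNReal.ofReal (D + D') := by
  obtain ⟨Cb, hCb⟩ := H.lipschitz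
  have hε := H.eps_pos n hn
  set G := γ (slowScale (v n) (slow k₀ (η n y - b θ₀)))
  have hG : 0 < G := hg.trans_le hgγ
  set τ : EuclideanSpace ℝ (Fin d) → ℝ := deviationThreshold (ε n) (ρ n) r₁ θ₀
  -- Insert the proxy; in the deviation term `G` is replaced by its lower bound `g`, which depends
  -- neither on `n` nor on `y`.
  have hpt : ∀ θ, |π θ * abcLikelihood (P n θ) (η n) (ε n) y / (L n * G * π θ₀)
      - limitShape B θ₀ R (ε n) θ|
      ≤ |π θ / π θ₀ * scaledProxy P η ε v b θ₀ γ L ρ r₁ (n, η n y) θ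
        - limitShape B θ₀ R (ε n) θ|
        + (L n * g * π θ₀)⁻¹ * (π θ *
          (P n θ).real (deviationEvent (η n) k₀ (ε n) (τ θ) (η n y) (b θ))) := by
    intro θ
    refine (abs_sub_le _ (π θ / π θ₀ * scaledProxy P η ε v b θ₀ γ L ρ r₁ (n, η n y) θ) _).trans ?_
    rw [add_comm]
    gcongr
    have h1 : π θ * abcLikelihood (P n θ) (η n) (ε n) y / (L n * G * π θ₀)
        - π θ / π θ₀ * scaledProxy P η ε v b θ₀ γ L ρ r₁ (n, η n y) θ
        = (L n * G * π θ₀)⁻¹ * (π θ * ((P n θ).real {z | ‖η n y - η n z‖ ≤ ε n}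
          - (P n θ).real (proxyEvent (η n) k₀ (ε n) (τ θ) (η n y) (b θ) (b θ₀)))) := by
      simp only [scaledProxy, abcLikelihood]
      rw [show γ (slowScale (v n) (slow k₀ (η n y - b θ₀))) = G from rfl]
      field_simp
      rfl
    rw [h1, abs_mul, abs_mul, abs_of_nonneg (hπ0 θ), abs_of_pos (by positivity)]
    have := hπ0 θ
    gcongr
    exact abs_real_sub_proxyEvent_le (P n θ) hε
  have hmeas : Measurable fun θ => ENNReal.ofReal |π θ / π θ₀ *
      scaledProxy P η ε v b θ₀ γ L ρ r₁ (n, η n y) θ - limitShape B θ₀ R (ε n) θ| :=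
    (measurable_norm.comp (((hπm.div_const _).mul
      (measurable_scaledProxy hη hCb.continuous.measurable _)).sub
        (measurable_limitShape B θ₀))).ennreal_ofReal
  calc _ ≤ ∫⁻ θ, (ENNReal.ofReal |π θ / π θ₀ * scaledProxy P η ε v b θ₀ γ L ρ r₁ (n, η n y) θ
            - limitShape B θ₀ R (ε n) θ|
          + ENNReal.ofReal (L n * g * π θ₀)⁻¹ * (ENNReal.ofReal (π θ) *
            P n θ (deviationEvent (η n) k₀ (ε n) (τ θ) (η n y) (b θ)))) := by
        refine lintegral_mono fun θ => ?_
        refine (ENNReal.ofReal_le_ofReal (hpt θ)).trans (ENNReal.ofReal_add_le.trans ?_)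
        rw [ENNReal.ofReal_mul (by positivity), ENNReal.ofReal_mul (hπ0 θ),
          ofReal_measureReal (measure_ne_top _ _)]
    _ = (∫⁻ θ, ENNReal.ofReal |π θ / π θ₀ * scaledProxy P η ε v b θ₀ γ L ρ r₁ (n, η n y) θ
            - limitShape B θ₀ R (ε n) θ|)
          + ENNReal.ofReal (L n * g * π θ₀)⁻¹ * deviationMass (P n) (η n) k₀ (ε n) τ b π (η n y) := by
        rw [lintegral_add_left hmeas, lintegral_const_mul' _ _ ENNReal.ofReal_ne_top]
        rfl
    _ ≤ ENNReal.ofReal D + ENNReal.ofReal (L n * g * π θ₀)⁻¹ *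
          ENNReal.ofReal (D' * (L n * g * π θ₀)) := by gcongr
    _ = ENNReal.ofReal (D + D') := by
        rw [← ENNReal.ofReal_mul (by positivity), ← ENNReal.ofReal_add hD (by positivity)]
        congr 1
        field_simp

/-- Convergence in probability of the posterior to the limiting density. -/
theorem tendsto_measure_not_tvDist_lt (H : SmallBallAsymptotics P η ε v b θ₀ δ R γ L)
    [Nontrivial (EuclideanSpace ℝ (Fin d))] (hk : k₀ < k) (hη : ∀ n, Measurable (η n))
    (hv : ∀ n, 1 ≤ n → Monotone (v n))
    (hvfast : ∀ j : FastIdx k k₀, Tendsto (fun n => v n j.1 * ε n) atTop atTop)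
    {Θ : Set (EuclideanSpace ℝ (Fin d))} {π : EuclideanSpace ℝ (Fin d) → ℝ} (hπm : Measurable π)
    (hπ0 : ∀ θ, 0 ≤ π θ) (hπs : ∀ θ, θ ∉ Θ → π θ = 0) (hπc : ContinuousAt π θ₀) (hπp : 0 < π θ₀)
    (hbdd : ∀ j : Fin k,
      BoundedInProbability (fun n => P n θ₀) (fun n z => v n j * (b θ₀ j - η n z j)))
    (hB : HasFDerivAt (fun θ => fast k₀ (b θ)) B θ₀)
    {c₁ : ℝ} (hc₁ : 0 < c₁) (hBc : ∀ x, c₁ * ‖x‖ ≤ ‖B x‖)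
    (hid : ∀ r : ℝ, 0 < r → ∃ a : ℝ, 0 < a ∧ ∀ θ ∈ Θ, r ≤ ‖θ - θ₀‖ →
      a ≤ ‖fast k₀ (b θ) - fast k₀ (b θ₀)‖)
    {u₀ κ : ℝ} (hu₀ : 0 < u₀) (hκ : (d : ℝ) < κ) {c : EuclideanSpace ℝ (Fin d) → ℝ}
    (hcπ : IntegrableOn (fun θ => c θ * π θ) Θ) (hcb : ∃ C : ℝ, ∀ᶠ θ in 𝓝 θ₀, c θ ≤ C)
    (htail : ∀ n, 1 ≤ n → ∀ u : ℝ, u₀ < u → ∀ θ ∈ Θ, ∀ j : Fin k, k₀ ≤ (j : ℕ) →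
      (P n θ).real {z | u < |normalised (v n) (b θ) (η n z) j|} ≤ c θ * u ^ (-κ))
    {e : ℝ} (he : 0 < e) :
    Tendsto (fun n => P n θ₀ {y | ¬ (0 < abcEvidence (P n) (η n) π (ε n) y ∧
        tvDist (abcPosterior (P n) (η n) π (ε n) y) (limitDensity B θ₀ R (ε n))
          < ENNReal.ofReal e)}) atTop (𝓝 0) := by
  obtain ⟨Cb, hCb⟩ := H.lipschitz
  have hR := H.exponent_nonneg
  have hk0 : (0 : ℝ) < k := by exact_mod_cast Nat.zero_lt_of_lt hk
  obtain ⟨Cc, hCc⟩ := hcb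
  have hnear : ∀ᶠ θ in 𝓝 θ₀, c θ * π θ ≤ (|Cc| + 1) * (2 * π θ₀) := by
    filter_upwards [hCc, hπc.eventually_lt_const (show π θ₀ < 2 * π θ₀ by linarith)] with θ h1 h2
    have h3 : c θ ≤ |Cc| + 1 := by linarith [le_abs_self Cc]
    calc c θ * π θ ≤ (|Cc| + 1) * π θ := mul_le_mul_of_nonneg_right h3 (hπ0 θ)
      _ ≤ _ := by gcongr
  obtain ⟨r₁, hr₁, hcC⟩ := Metric.eventually_nhds_iff_ball.1 hnear
  obtain ⟨c₀, hc₀, hsep⟩ := exists_mul_min_le_norm_sub hB hc₁ hBc hid hr₁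
  -- This choice balances two needs: `ρ → 0` makes the threshold negligible relative to `ε` at scale
  -- `ε`, while `v ρ ε = √(v ε) → ∞` makes deviations beyond it rare.
  set ρ : ℕ → ℝ := fun n => (√(v n ⟨k₀, hk⟩ * ε n))⁻¹ with hρdef
  have hsqrt : Tendsto (fun n => √(v n ⟨k₀, hk⟩ * ε n)) atTop atTop :=
    Real.tendsto_sqrt_atTop.comp (hvfast ⟨⟨k₀, hk⟩, le_rfl⟩)
  have hρpos : ∀ n, 1 ≤ n → 0 < ρ n := fun n hn =>
    inv_pos.2 (Real.sqrt_pos.2 (mul_pos (H.rate_pos n hn _) (H.eps_pos n hn)))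
  have hρ : Tendsto ρ atTop (𝓝 0) := hsqrt.inv_tendsto_atTop
  have hρv : Tendsto (fun n => v n ⟨k₀, hk⟩ * ρ n * ε n) atTop atTop := by
    refine hsqrt.congr' ?_
    filter_upwards [eventually_ge_atTop 1] with n hn
    rw [hρdef, mul_right_comm, ← div_eq_mul_inv, Real.div_sqrt]
  set I := ∫ x, limitShape B 0 R 1 x with hIdef
  have hI : 0 < I := integral_limitShape_pos 0 hc₁ hBc hR one_pos
  -- Proxy and deviations contribute `e₁ * ε n ^ d` each, and normalising doubles their sum.
  obtain ⟨e₁, he₁, he₁I, he₁e⟩ : ∃ e₁ : ℝ, 0 < e₁ ∧ 2 * e₁ < I ∧ 4 * e₁ / I < e := by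
    refine ⟨min (I / 4) (e * I / 8), by positivity, ?_, ?_⟩
    · linarith [min_le_left (I / 4) (e * I / 8)]
    · rw [div_lt_iff₀ hI]
      have := min_le_right (I / 4) (e * I / 8)
      have : 0 < e * I := by positivity
      linarith
  rw [← ENNReal.tendsto_toReal_zero_iff (fun n => measure_ne_top _ _), Metric.tendsto_nhds]
  intro e₂ he₂
  -- The `k` components together cost `e₂ / 4`; Markov's inequality will cost another `e₂ / 4`.
  choose Mj hMj using fun j => hbdd j (e₂ / (4 * k)) (by positivity)
  set M := ∑ j : SlowIdx k k₀, Mj j.1 with hM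
  obtain ⟨g, hg, hgγ⟩ := H.exists_le_density M
  obtain ⟨a, ha, hproxy⟩ := exists_of_eventually_typicalFilter
    (H.eventually_lintegral_scaledProxy_sub_le hη hπm hπ0 hπs hπc hπp hB
      (fun n hn => (hρpos n hn).le) hρ hr₁ hc₁ hBc hc₀ hsep M he₁)
  -- The mean is required to be at most `e₂ / 4` times the Markov level `s` introduced below.
  have hdev := H.eventually_setLIntegral_deviationMass_le hk hη hv hπm hπ0 hπs hu₀ hκ hcπ
    (C := (|Cc| + 1) * (2 * π θ₀)) (by positivity) hr₁ hcC htail hρpos hρv M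
    (e := e₁ * g * π θ₀ * (e₂ / 4)) (by positivity)
  -- Each fast component of `η n y - b θ₀` is then at most `a * ε n / (2 * k)`, so their norm is at
  -- most `a * ε n / 2`, as typicality requires.
  have hfast : ∀ᶠ n in atTop, ∀ j : FastIdx k k₀, Mj j.1 * (2 * k / a) ≤ v n j.1 * ε n :=
    eventually_all.2 fun j => (hvfast j).eventually_ge_atTop _
  filter_upwards [eventually_all.2 hMj, hproxy, hdev, hfast, H.eventually_pos,
    eventually_ge_atTop 1] with n hMn hpn hdn hfn hL hn
  have hε := H.eps_pos n hn
  set G : Set (Ω n) := {y | ‖slowScale (v n) (slow k₀ (η n y - b θ₀))‖ ≤ M} with hG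
  have hGm : MeasurableSet G := measurableSet_le
    ((continuous_slowScale (v n)).measurable.comp
      ((measurable_slow k₀).comp ((hη n).sub_const _))).norm measurable_const
  set T : Ω n → ℝ≥0∞ := fun y =>
    deviationMass (P n) (η n) k₀ (ε n) (deviationThreshold (ε n) (ρ n) r₁ θ₀) b π (η n y) with hT
  have hTm : Measurable T :=
    measurable_deviationMass (hη n) measurable_deviationThreshold hCb.continuous.measurable hπm
  set D := e₁ * ε n ^ d with hD
  have hDpos : 0 < D := by positivity
  set s := D * (L n * g * π θ₀) with hs
  have hspos : 0 < s := by positivity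
  have hsub : {y | ¬ (0 < abcEvidence (P n) (η n) π (ε n) y ∧
      tvDist (abcPosterior (P n) (η n) π (ε n) y) (limitDensity B θ₀ R (ε n)) < ENNReal.ofReal e)}
      ⊆ (⋃ j : Fin k, {z | Mj j < |v n j * (b θ₀ j - η n z j)|})
        ∪ ({y | ENNReal.ofReal s ≤ T y} ∩ G) := by
    intro y hy
    by_contra hcon
    rw [Set.mem_union, not_or, Set.mem_iUnion, not_exists] at hcon
    obtain ⟨hcon1, hcon2⟩ := hcon
    have hz : ∀ j : Fin k, |v n j * (η n y j - b θ₀ j)| ≤ Mj j := by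
      intro j
      have : |v n j * (b θ₀ j - η n y j)| ≤ Mj j := not_lt.1 (hcon1 j)
      rwa [abs_mul, abs_sub_comm, ← abs_mul] at this
    have hyG : y ∈ G :=
      (norm_slowScale_le_sum (v n) _).trans (Finset.sum_le_sum fun j _ => hz j.1)
    have hyT : T y ≤ ENNReal.ofReal s := (not_le.1 fun h => hcon2 ⟨h, hyG⟩).le
    have hyfast : |‖fast k₀ (η n y - b θ₀)‖ / ε n| < a := by
      rw [abs_of_nonneg (by positivity), div_lt_iff₀ hε]
      have h1 : ∀ j : FastIdx k k₀, |(η n y - b θ₀) j.1| ≤ a * ε n / (2 * k) := by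
        intro j
        have hvj := H.rate_pos n hn j.1
        have h2 := hz j.1
        have h3 := hfn j
        rw [abs_mul, abs_of_pos hvj] at h2
        rw [← mul_div_assoc, div_le_iff₀ ha] at h3
        rw [le_div_iff₀ (by positivity)]
        refine le_of_mul_le_mul_left ?_ hvj
        calc v n j.1 * (|(η n y - b θ₀) j.1| * (2 * k))
            = v n j.1 * |η n y j.1 - b θ₀ j.1| * (2 * k) := by rw [PiLp.sub_apply]; ring
          _ ≤ Mj j.1 * (2 * k) := by gcongr
          _ ≤ _ := h3.trans_eq (by ring)
      have h2 := norm_fast_le_mul k₀ _ (by positivity) h1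
      have h3 : (k : ℝ) * (a * ε n / (2 * k)) = a * ε n / 2 := by field_simp
      have : 0 < a * ε n := by positivity
      linarith
    have hclose := H.lintegral_abcLikelihood_sub_le hη hπm hπ0 hπp hn hL hg (hgγ _ hyG) hDpos.le
      hDpos.le (hpn _ hyG hyfast) hyT
    have hIn : ∫ θ, limitShape B θ₀ R (ε n) θ = ε n ^ d * I := integral_limitShape_eq B θ₀ hε
    refine hy (abcEvidence_pos_and_tvDist_lt (hη n) hπm hπ0
      (integrable_limitShape θ₀ hc₁ hBc hR hε)
      (mul_pos (mul_pos hL (H.density_pos _)) hπp) (by positivity) hclose ?_ ?_)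
    · rw [hIn, hD]
      have : 0 < ε n ^ d := by positivity
      nlinarith
    · rw [hIn, hD]
      refine lt_of_eq_of_lt ?_ he₁e
      field_simp
      ring
  have hmarkov : (P n θ₀).real ({y | ENNReal.ofReal s ≤ T y} ∩ G) ≤ e₂ / 4 := by
    have h1 := mul_meas_ge_le_lintegral₀ (μ := (P n θ₀).restrict G) hTm.aemeasurable
      (ENNReal.ofReal s)
    rw [Measure.restrict_apply (measurableSet_le measurable_const hTm)] at h1
    have h2 := h1.trans hdn
    have h3 : e₁ * g * π θ₀ * (e₂ / 4) * (L n * ε n ^ d) = s * (e₂ / 4) := by rw [hs, hD]; ring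
    rw [h3, ← ofReal_measureReal (measure_ne_top _ _), ← ENNReal.ofReal_mul hspos.le] at h2
    have h4 := (ENNReal.ofReal_le_ofReal_iff (by positivity)).1 h2
    exact le_of_mul_le_mul_left h4 hspos
  have hbound : (P n θ₀).real (⋃ j : Fin k, {z | Mj j < |v n j * (b θ₀ j - η n z j)|}) ≤ e₂ / 4 := by
    refine (measureReal_iUnion_fintype_le _).trans ((Finset.sum_le_sum fun j _ => hMn j).trans ?_)
    rw [Finset.sum_const, nsmul_eq_mul, Finset.card_univ, Fintype.card_fin]
    refine le_of_eq ?_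
    field_simp
  have htotal := (measureReal_mono (μ := P n θ₀) hsub).trans (measureReal_union_le _ _)
  rw [dist_zero_right, Real.norm_of_nonneg ENNReal.toReal_nonneg]
  refine htotal.trans_lt ?_
  linarith

end SmallBallAsymptotics

end ABC

end

theorem theorem2
    -- dimensions: `d` parameters, `k` summary statistics, the first `k₀` of them slow
    (d k k₀ : ℕ) (hd : 1 ≤ d) (hk₀ : 1 ≤ k₀) (hk : k₀ < k)
    -- the model for data in `ℝⁿ`, the summary statistics, the tolerance
    (P : (n : ℕ) → Kernel (EuclideanSpace ℝ (Fin d)) (Fin n → ℝ)) [∀ n, IsMarkovKernel (P n)]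
    (η : (n : ℕ) → (Fin n → ℝ) → EuclideanSpace ℝ (Fin k)) (hη : ∀ n, Measurable (η n))
    (ε : ℕ → ℝ) (hε_pos : ∀ n, 1 ≤ n → 0 < ε n) (hε : Tendsto ε atTop (𝓝 0))
    -- the parameter space, the true parameter and the prior density
    (Θ : Set (EuclideanSpace ℝ (Fin d))) (hΘ : MeasurableSet Θ)
    (θ₀ : EuclideanSpace ℝ (Fin d))
    (π : EuclideanSpace ℝ (Fin d) → ℝ) (hπ_meas : Measurable π) (hπ_nonneg : ∀ θ, 0 ≤ π θ)
    (hπ_supp : ∀ θ, θ ∉ Θ → π θ = 0) (hπ_int : Integrable π) (hπ_one : ∫ θ, π θ = 1)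
    (hπ_cont : ContinuousAt π θ₀) (hπ_pos : 0 < π θ₀)
    -- limits and rates of the summary statistics
    (b : EuclideanSpace ℝ (Fin d) → EuclideanSpace ℝ (Fin k))
    (hb : ∃ C : ℝ≥0, LipschitzWith C b)
    (v : ℕ → Fin k → ℝ) (hv_pos : ∀ n, 1 ≤ n → ∀ j, 0 < v n j)
    (hv_mono : ∀ n, 1 ≤ n → Monotone (v n))
    (hv_bdd : ∀ θ ∈ Θ, ∀ j : Fin k,
      ABC.BoundedInProbability (fun n => P n θ) (fun n z => v n j * (b θ j - η n z j)))
    (hv_slow : ∀ j : Fin k, (j : ℕ) < k₀ → Tendsto (fun n => v n j * ε n) atTop (𝓝 0))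
    (hv_fast : ∀ j : Fin k, k₀ ≤ (j : ℕ) → Tendsto (fun n => v n j * ε n) atTop atTop)
    -- the derivative at `θ₀` of the fast part of `b` has full (column) rank, and the fast part of
    -- `b` separates `θ₀` from the parameters away from it
    (B : EuclideanSpace ℝ (Fin d) →L[ℝ] EuclideanSpace ℝ (ABC.FastIdx k k₀))
    (hB : HasFDerivAt (fun θ => ABC.fast k₀ (b θ)) B θ₀)
    (hB_rank : Module.finrank ℝ (LinearMap.range B.toLinearMap) = d)
    (hb_ident : ∀ r : ℝ, 0 < r → ∃ a : ℝ, 0 < a ∧ ∀ θ ∈ Θ, r ≤ ‖θ - θ₀‖ →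
      a ≤ ‖ABC.fast k₀ (b θ) - ABC.fast k₀ (b θ₀)‖)
    -- small balls of the slow statistics
    (δ : ℝ) (hδ : 0 < δ) (R : ℝ) (hR : 0 ≤ R)
    (γ : EuclideanSpace ℝ (ABC.SlowIdx k k₀) → ℝ) (hγ_pos : ∀ m, 0 < γ m)
    (hγ_bdd : ∃ C : ℝ, ∀ m, γ m ≤ C) (hγ_lip : ∃ C : ℝ≥0, LipschitzWith C γ)
    (L : ℕ → ℝ) (hL : Tendsto L atTop (𝓝 0))
    (h_ball : ∀ K : Set (EuclideanSpace ℝ (ABC.SlowIdx k k₀)), IsCompact K →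
      ∀ t : ℝ, 0 < t → t ≤ 1 →
        TendstoUniformlyOn
          (fun n (p : EuclideanSpace ℝ (Fin d) × EuclideanSpace ℝ (ABC.SlowIdx k k₀)) =>
            (P n p.1).real {z | ∑ j : ABC.SlowIdx k k₀,
                (ABC.normalised (v n) (b p.1) (η n z) j.1 - p.2 j) ^ 2 / v n j.1 ^ 2
                  < t ^ 2 * ε n ^ 2}
              / (t ^ R * L n))
          (fun p => γ p.2) atTop (Metric.ball θ₀ δ ×ˢ K))
    -- tails of the fast statistics
    (u₀ : ℝ) (hu₀ : 0 < u₀)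
    (h_tail : ∃ κ : ℝ, (d : ℝ) < κ ∧
      (fun n => v n ⟨k₀, hk⟩ ^ (-κ)) =o[atTop] (fun n => L n * ε n ^ d) ∧
      ∃ c : EuclideanSpace ℝ (Fin d) → ℝ,
        IntegrableOn (fun θ => c θ * π θ) Θ ∧
        (∃ C : ℝ, ∀ᶠ θ in 𝓝 θ₀, c θ ≤ C) ∧
        ∀ n, 1 ≤ n → ∀ u : ℝ, u₀ < u → ∀ θ ∈ Θ, ∀ j : Fin k, k₀ ≤ (j : ℕ) →
          (P n θ).real {z | u < |ABC.normalised (v n) (b θ) (η n z) j|} ≤ c θ * u ^ (-κ))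
    -- conditional tails of the fast statistics given the slow ones
    (h_cond : ∀ M : ℝ, 0 < M → ∃ M₂ : ℝ, 0 < M₂ ∧ ∃ κ : ℝ, (d : ℝ) < κ ∧
      ∃ u : ℕ → ℝ, Monotone u ∧ (∀ n, u₀ ≤ u n) ∧
        u =o[atTop] (fun n => v n ⟨k₀, hk⟩ * ε n) ∧
        (∀ᶠ n in atTop, ∀ s : ℝ, u n ≤ s → ∀ θ, ‖θ - θ₀‖ ≤ δ → ∀ j : Fin k, k₀ ≤ (j : ℕ) →
          ∀ᵐ m ∂((P n θ).map (fun z => ABC.slow k₀ (ABC.normalised (v n) (b θ) (η n z)))),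
            ‖m‖ ≤ M →
              (condDistrib (fun z => ABC.normalised (v n) (b θ) (η n z) j)
                (fun z => ABC.slow k₀ (ABC.normalised (v n) (b θ) (η n z))) (P n θ) m).real
                  {x : ℝ | s < |x|} ≤ M₂ * s ^ (-κ)) ∧
        (fun n => (v n ⟨k₀ - 1, by omega⟩ / v n ⟨k₀, hk⟩) ^ (κ - d) *
            (ε n * v n ⟨k₀, hk⟩) ^ (-(d : ℝ))) =o[atTop] L) :
    -- the limiting shape can be normalised to a probability density ...
    (∀ n, 1 ≤ n → Integrable (ABC.limitShape B θ₀ R (ε n)) ∧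
      0 < ∫ θ, ABC.limitShape B θ₀ R (ε n) θ) ∧
    -- ... and, in probability under `θ₀`, the ABC posterior is well defined and its total
    -- variation distance to that density tends to `0`
    ∀ e : ℝ, 0 < e →
      Tendsto (fun n => P n θ₀ {y | ¬ (0 < ABC.abcEvidence (P n) (η n) π (ε n) y ∧
          ABC.tvDist (ABC.abcPosterior (P n) (η n) π (ε n) y) (ABC.limitDensity B θ₀ R (ε n))
            < ENNReal.ofReal e)})
        atTop (𝓝 0) := by
  obtain ⟨c₁, hc₁, hBc⟩ := ABC.exists_mul_norm_le_of_finrank_range_eq B hB_rank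
  have H : ABC.SmallBallAsymptotics P η ε v b θ₀ δ R γ L :=
    { eps_pos := hε_pos
      eps_tendsto := hε
      rate_pos := hv_pos
      rate_slow := fun j => hv_slow j.1 j.2
      lipschitz := hb
      radius_pos := hδ
      exponent_nonneg := hR
      density_pos := hγ_pos
      density_bdd := hγ_bdd
      density_lipschitz := hγ_lip
      ball := h_ball }
  have hθ₀ : θ₀ ∈ Θ := by
    by_contra h
    exact hπ_pos.ne' (hπ_supp θ₀ h)
  -- This makes the parameter space nontrivial, so that the point `x = 0` is Lebesgue null.
  have : Nonempty (Fin d) := ⟨⟨0, hd⟩⟩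
  obtain ⟨κ, hκ, -, c, hcπ, hcb, htail⟩ := h_tail
  refine ⟨fun n hn => ⟨ABC.integrable_limitShape θ₀ hc₁ hBc hR (hε_pos n hn),
    ABC.integral_limitShape_pos θ₀ hc₁ hBc hR (hε_pos n hn)⟩, fun e he => ?_⟩
  exact H.tendsto_measure_not_tvDist_lt hk hη hv_mono (fun j => hv_fast j.1 j.2) hπ_meas hπ_nonneg
    hπ_supp hπ_cont hπ_pos (hv_bdd θ₀ hθ₀) hB hc₁ hBc hb_ident hu₀ hκ hcπ hcb htail he
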